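/- Let $b:\mathbb{R}^2\to\mathbb{R}^2$ be a $C^\infty$ vector field with a stable attracting (asymptotically stable) equilibrium $\mathcal O$. Let $$U(x)=\inf\Big\{\int_0^L\big[\|\dot\varphi_r\|\,\|b(\varphi_r)\|-\dot\varphi_r\cdot b(\varphi_r)\big]\,dr:\ L>0,\ \varphi:[0,L]\to\mathbb{R}^2\text{ absolutely continuous},\ \varphi_0=\mathcal O,\ \varphi_L=x\Big\}$$ be its quasipotential. Fix $y\in\mathbb{R}^2$ with $b(y)\neq0$, put $\hat b=b(y)/\|b(y)\|$, and let $\varphi:[0,L]\to\mathbb{R}^2$ be a minimum action path (MAP) through $y$: $\varphi$ is continuous, $\varphi_0=\mathcal O$, $\varphi_L=y$, $\varphi$ is absolutely continuous on $[\varepsilon,L]$ for each $\varepsilon\in(0,L)$ (so infinite length near $\mathcal O$ is allowed), and its action equals $U(y)$. Assume that $\varphi$ stays in the basin of attraction of $\mathcal O$. Let $D=(\hat u_k)_{k\in\mathbb{Z}}$ be a rotationally ordered collection of unit directions going once around the circle: $\hat u_k=(\cos\theta_k,\sin\theta_k)$ with $\theta_k<\theta_{k+1}<\theta_k+\pi$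 for all $k$, and either $\theta_{k+n}=\theta_k+2\pi$ for all $k$ and some fixed $n\ge1$ (finite collection, listed periodically), or $\theta_k\to a$ as $k\to-\infty$ and $\theta_k\to a+2\pi$ as $k\to+\infty$ for some $a$ (infinite collection). The neighbours are the pairs $\hat u=\hat u_k$, $\hat v=\hat u_{k+1}$. Suppose that all neighbours satisfy $$\hat u\cdot\hat v\ \ge\ \max(-\hat u\cdot\hat b,\,-\hat v\cdot\hat b,\,0).$$ Suppose moreover that, if some $\hat w\in D$ happens to be exactly the tangent of $\varphi$ at $y$, traced backwards from $y$ (that is, $(z-y)/\|z-y\|\to\hat w$ as $z\to y$ with $z$ on the path, $z\ne y$), then $\hat w\cdot\hat v>-\hat v\cdot\hat b$ for both neighbours $\hat v$ of $\hat w$. Then there are neighbours $\hat u,\hat v\in D$ such that, for arbitrarily small $h>0$, the path $\varphi$ passes between $A:=y+h\hat u$ and $B:=y+h\hat v$, while $U(A)<U(y)$ and $U(B)<U(y)$. Here $\varphi$ passes between $A$ and $B$ if it meets the closed segment $AB$ at some time $r<L$ and stays within distance $h$ of $y$ during $[r,L]$. If no direction in $D$ is the backward tangent of $\varphi$ at $y$,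 the same neighbours $\hat u,\hat v$ have these properties for all sufficiently small $h>0$. -/

import Mathlib

open Set Filter Topology MeasureTheory
open scoped ENNReal ContDiff

noncomputable section

namespace Quasipotential

/-- The Euclidean plane. -/
abbrev Plane : Type := EuclideanSpace ℝ (Fin 2)

/-! ### The deterministic dynamics -/

/-- The basin of attraction of `O` for the flow `x' = b(x)`: the starting points of forward
solutions that converge to `O`. -/
def basin (b : Plane → Plane) (O : Plane) : Set Plane :=
  {x | ∃ γ : ℝ → Plane, IsIntegralCurveOn γ (fun _ => b) (Ici 0) ∧ γ 0 = x ∧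
    Tendsto γ atTop (𝓝 O)}

/-- `O` is a stable attracting (that is, asymptotically stable) equilibrium of `x' = b(x)`. -/
structure IsStableAttractor (b : Plane → Plane) (O : Plane) : Prop where
  equilibrium : b O = 0
  stable : ∀ ε > 0, ∃ δ > 0, ∀ γ : ℝ → Plane, IsIntegralCurveOn γ (fun _ => b) (Ici 0) →
    dist (γ 0) O < δ → ∀ t ≥ 0, dist (γ t) O < ε
  attracting : basin b O ∈ 𝓝 O

/-! ### The geometric action, the quasipotential and minimum action paths -/

/-- The integrand `‖φ'‖ ‖b(φ)‖ - φ' · b(φ)` of the geometric action; it is nonnegative by the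
Cauchy-Schwarz inequality, so that `ENNReal.ofReal` loses nothing. -/
def costRate (b : Plane → Plane) (φ : ℝ → Plane) (r : ℝ) : ℝ≥0∞ :=
  ENNReal.ofReal (‖deriv φ r‖ * ‖b (φ r)‖ - inner ℝ (deriv φ r) (b (φ r)))

open Classical in
/-- The geometric action of `φ` on `[0, L]`, infinite if `φ` is not absolutely continuous. -/
def geometricAction (b : Plane → Plane) (L : ℝ) (φ : ℝ → Plane) : ℝ≥0∞ :=
  if AbsolutelyContinuousOnInterval φ 0 L then ∫⁻ r in Ioc 0 L, costRate b φ r else ⊤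

/-- The quasipotential with respect to `O`: the infimum of the geometric action over all
paths on an interval `[0, L]`, `L > 0`, from `O` to `x`. -/
def quasipotential (b : Plane → Plane) (O x : Plane) : ℝ≥0∞ :=
  ⨅ (L : ℝ) (φ : ℝ → Plane) (_ : 0 < L) (_ : ContinuousOn φ (Icc 0 L)) (_ : φ 0 = O)
    (_ : φ L = x), geometricAction b L φ

/-- `φ`, on `[0, L]`, is a minimum action path through (ending at) `y`: it starts at `O`, ends
at `y`, and its geometric action is the quasipotential of `y`. Absolute continuity is required on
`[ε, L]` for every `ε > 0` only, so that paths that have infinite length near `O` are included. -/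
structure IsMAP (b : Plane → Plane) (O y : Plane) (L : ℝ) (φ : ℝ → Plane) : Prop where
  pos : 0 < L
  continuousOn : ContinuousOn φ (Icc 0 L)
  start : φ 0 = O
  finish : φ L = y
  absCont : ∀ ε ∈ Ioo 0 L, AbsolutelyContinuousOnInterval φ ε L
  action_eq : ∫⁻ r in Ioc 0 L, costRate b φ r = quasipotential b O y

/-- The direction `d` is the tangent at `φ L` of the path `φ` on `[0, L]`, traced backwards from
its endpoint: `(z - y) / ‖z - y‖ → d` as `z` tends to `y = φ L` along the rest of the path. -/
def IsBackwardTangent (φ : ℝ → Plane) (L : ℝ) (d : Plane) : Prop :=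
  Tendsto (fun z => ‖z - φ L‖⁻¹ • (z - φ L)) (𝓝[φ '' Icc 0 L \ {φ L}] (φ L)) (𝓝 d)

/-- On its way into its endpoint, the path `φ` on `[0, L]` passes between `A` and `B`: it crosses
the segment from `A` to `B`, and stays within distance `h` of the endpoint from then on. -/
def PassesBetween (φ : ℝ → Plane) (L h : ℝ) (A B : Plane) : Prop :=
  ∃ r ∈ Ico 0 L, φ r ∈ segment ℝ A B ∧ ∀ t ∈ Icc r L, φ t ∈ Metric.closedBall (φ L) h

/-! ### Rotationally ordered collections of directions -/

/-- The unit direction with polar angle `θ`. -/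
def direction (θ : ℝ) : Plane := !₂[Real.cos θ, Real.sin θ]

/-- `D k`, `k ∈ ℤ`, lists unit directions in their rotational (counterclockwise) order, once around
the circle; the neighbours are `D k` and `D (k + 1)`. The polar angles `θ k` increase strictly,
consecutive ones enclose less than a half-turn, and together they make exactly one full turn:
either the collection is finite and the list is periodic, or the collection is infinite, and the
angles range between two limits that differ by `2π`. -/
def RotationallyOrdered (D : ℤ → Plane) : Prop :=
  ∃ θ : ℤ → ℝ, (∀ k, D k = direction (θ k)) ∧ StrictMono θ ∧
    (∀ k, θ (k + 1) - θ k < Real.pi) ∧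
    ((∃ n : ℤ, 0 < n ∧ ∀ k, θ (k + n) = θ k + 2 * Real.pi) ∨
      ∃ a : ℝ, Tendsto θ atBot (𝓝 a) ∧ Tendsto θ atTop (𝓝 (a + 2 * Real.pi)))

end Quasipotential

end

open scoped NNReal

namespace Quasipotential

/-! ### Absolutely continuous curves -/

section AbsolutelyContinuous

variable {E : Type*} [NormedAddCommGroup E] [NormedSpace ℝ E]

/-! Write `ℓ(t)` for the length of the path from time `t` to its end. The plan is to show that the
path has a tangent `w` at `y`, that `w ≠ -bhat`, and that `U` decreases from `y` in every unit
direction `u` with `u·w + u·bhat > 0`.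

A minimum action path is calibrated: along it, `U` grows by exactly the action spent
(`IsMAP.toReal_quasipotential_eq`). Pushing the path sideways by a tent function of its arc length
cannot lower the action. To first order this says that the averages of the momentum `P = ‖b‖φ' -
‖φ'‖b` over two adjacent pieces differ by at most a constant times the integral of `‖P‖` over both
(`norm_average_momentum_sub_le`). The effect of moving the base point is itself controlled by `P`,
because the derivative of the Lagrangian in direction `Δ` of `b` is `-P·Δ/‖b‖`.

Two consequences follow. The averages of `P` over the final pieces converge. As comparison with the
chord shows that length and chord agree to first order at `y`, the quotient `(φ t - y)/ℓ(t)` tends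
to a unit vector `w`, with limiting momentum `-(‖b y‖w + b y)` (`IsMAP.exists_tangent`). If this
limit were zero, that is `w = -bhat`, a backward Gronwall argument would make `P` vanish along the
path. The path would then follow the flow from arbitrarily near `O` to `y`, against stability
(`IsMAP.not_tendsto_avgMomentum_zero`).

Descent: reach `y + hu` by leaving the path at length `C h` before `y` and going straight. With `C`
large, this costs less than going on to `y` as soon as `u·w + u·bhat > 0`
(`IsMAP.eventually_quasipotential_lt`).

Finally, `-bhat` neither belongs to `D` nor lies strictly between neighbours, by the inequality on
neighbours; so it is the accumulation direction of `D`. Since `w ≠ -bhat`, either `w` lies strictly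
between neighbours `u`, `v`, whence `u·w > u·v ≥ -u·bhat` and likewise for `v`, or `w` belongs to
`D`. In the latter case the strict inequalities give descent at `w` and both its neighbours, but the
path may oscillate about the ray along `w`. One of the two adjacent sectors is then crossed for
arbitrarily small `h` only. -/

theorem absolutelyContinuousOnInterval_of_dist_le {X Y : Type*} [PseudoMetricSpace X]
    [PseudoMetricSpace Y] {f : ℝ → X} {g : ℝ → Y} {a b : ℝ}
    (hg : AbsolutelyContinuousOnInterval g a b)
    (h : ∀ x ∈ uIcc a b, ∀ y ∈ uIcc a b, dist (f x) (f y) ≤ dist (g x) (g y)) :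
    AbsolutelyContinuousOnInterval f a b := by
  rw [absolutelyContinuousOnInterval_iff] at hg ⊢
  intro ε hε
  obtain ⟨δ, hδ, H⟩ := hg ε hε
  refine ⟨δ, hδ, fun E hE hlt => lt_of_le_of_lt ?_ (H E hE hlt)⟩
  exact Finset.sum_le_sum fun i hi => h _ (hE.1 i hi).1 _ (hE.1 i hi).2

theorem absolutelyContinuousOnInterval_primitive {f : ℝ → E} {a b : ℝ}
    (hf : IntervalIntegrable f volume a b) :
    AbsolutelyContinuousOnInterval (fun x => ∫ t in a..x, f t) a b := by
  refine absolutelyContinuousOnInterval_of_dist_le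
    (hf.norm.absolutelyContinuousOnInterval_intervalIntegral (c := a) left_mem_uIcc) ?_
  intro x hx y hy
  have hi : ∀ z ∈ uIcc a b, IntervalIntegrable f volume a z := fun z hz =>
    hf.mono_set (uIcc_subset_uIcc_left hz)
  rw [dist_eq_norm, dist_eq_norm, intervalIntegral.integral_interval_sub_left (hi x hx) (hi y hy),
    intervalIntegral.integral_interval_sub_left (hi x hx).norm (hi y hy).norm, Real.norm_eq_abs]
  exact intervalIntegral.norm_integral_le_abs_integral_norm

theorem ae_differentiableAt_of_absolutelyContinuous [FiniteDimensional ℝ E] {f : ℝ → E} {a b : ℝ}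
    (hf : AbsolutelyContinuousOnInterval f a b) :
    ∀ᵐ x, x ∈ uIcc a b → DifferentiableAt ℝ f x :=
  hf.boundedVariationOn.ae_differentiableAt_of_mem_uIcc

theorem intervalIntegrable_deriv_of_absolutelyContinuous {f : ℝ → Plane} {a b : ℝ}
    (hf : AbsolutelyContinuousOnInterval f a b) :
    IntervalIntegrable (deriv f) volume a b := by
  have hc : ∀ i, IntervalIntegrable (fun t => deriv (fun s => f s i) t) volume a b := fun i =>
    (absolutelyContinuousOnInterval_of_dist_le hf fun x _ y _ => by
      simpa [dist_eq_norm] using PiLp.norm_apply_le (f x - f y) i).intervalIntegrable_deriv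
  have hd := ae_differentiableAt_of_absolutelyContinuous hf
  have hb : ∀ᵐ t, t ∈ uIcc a b →
      ‖deriv f t‖ ≤ ‖deriv (fun s => f s 0) t‖ + ‖deriv (fun s => f s 1) t‖ := by
    filter_upwards [hd] with t ht htm
    have h1 : ∀ i, deriv (fun s => f s i) t = deriv f t i := fun i =>
      (((EuclideanSpace.proj (𝕜 := ℝ) (ι := Fin 2) i).hasFDerivAt.comp_hasDerivAt t
        (ht htm).hasDerivAt)).deriv
    rw [h1, h1, EuclideanSpace.norm_eq]
    refine Real.sqrt_le_iff.2 ⟨by positivity, ?_⟩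
    simp only [Fin.sum_univ_two]
    nlinarith [norm_nonneg (deriv f t 0), norm_nonneg (deriv f t 1)]
  refine ((hc 0).norm.add (hc 1).norm).mono_fun' (aestronglyMeasurable_deriv f _) ?_
  refine (ae_restrict_iff' measurableSet_uIoc).2 ?_
  filter_upwards [hb] with t ht htm
  exact ht (uIoc_subset_uIcc htm)

/-- The difference between `f` and the primitive of its derivative is absolutely continuous with
zero derivative almost everywhere, hence constant. -/
theorem integral_deriv_of_absolutelyContinuous {f : ℝ → Plane} {a b : ℝ}
    (hf : AbsolutelyContinuousOnInterval f a b) :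
    ∫ t in a..b, deriv f t = f b - f a := by
  have hi := intervalIntegrable_deriv_of_absolutelyContinuous hf
  have hg : AbsolutelyContinuousOnInterval (fun x => f x - ∫ t in a..x, deriv f t) a b :=
    hf.fun_sub (absolutelyContinuousOnInterval_primitive hi)
  obtain ⟨C, hC⟩ := hg.const_of_ae_hasDerivAt_zero (by
    filter_upwards [ae_differentiableAt_of_absolutelyContinuous hf,
      hi.ae_hasDerivAt_integral] with x h1 h2 hx
    have h3 := (h1 hx).hasDerivAt.fun_sub (h2 hx a left_mem_uIcc)
    rwa [sub_self] at h3)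
  have h1 := hC a left_mem_uIcc
  have h2 := hC b right_mem_uIcc
  simp only [intervalIntegral.integral_same, sub_zero] at h1
  rw [h1, ← h2]; abel

theorem absolutelyContinuousOnInterval_of_eq_primitive {f g : ℝ → E} {a b : ℝ}
    (hg : IntervalIntegrable g volume a b)
    (h : ∀ x ∈ uIcc a b, f x = f a + ∫ t in a..x, g t) :
    AbsolutelyContinuousOnInterval f a b :=
  absolutelyContinuousOnInterval_of_dist_le (absolutelyContinuousOnInterval_primitive hg)
    fun x hx y hy => by rw [h x hx, h y hy, dist_add_left]

theorem eq_primitive_of_absolutelyContinuous {f : ℝ → Plane} {a b : ℝ}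
    (hf : AbsolutelyContinuousOnInterval f a b) {x : ℝ} (hx : x ∈ uIcc a b) :
    f x = f a + ∫ t in a..x, deriv f t := by
  rw [integral_deriv_of_absolutelyContinuous (hf.mono (uIcc_subset_uIcc_left hx))]; abel

theorem absolutelyContinuousOnInterval_trans {f : ℝ → Plane} {a b c : ℝ}
    (hab : a ≤ b) (hbc : b ≤ c) (h1 : AbsolutelyContinuousOnInterval f a b)
    (h2 : AbsolutelyContinuousOnInterval f b c) : AbsolutelyContinuousOnInterval f a c := by
  have i1 := intervalIntegrable_deriv_of_absolutelyContinuous h1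
  have i2 := intervalIntegrable_deriv_of_absolutelyContinuous h2
  refine absolutelyContinuousOnInterval_of_eq_primitive (i1.trans i2) fun x hx => ?_
  rw [uIcc_of_le (hab.trans hbc)] at hx
  rcases le_total x b with hxb | hxb
  · exact eq_primitive_of_absolutelyContinuous h1 (by rw [uIcc_of_le hab]; exact ⟨hx.1, hxb⟩)
  · have hm : x ∈ uIcc b c := by rw [uIcc_of_le hbc]; exact ⟨hxb, hx.2⟩
    rw [← intervalIntegral.integral_add_adjacent_intervals i1
      (i2.mono_set (uIcc_subset_uIcc_left hm)), ← add_assoc,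
      ← eq_primitive_of_absolutelyContinuous h1 right_mem_uIcc]
    exact eq_primitive_of_absolutelyContinuous h2 hm

theorem absolutelyContinuousOnInterval_congr {X : Type*} [PseudoMetricSpace X]
    {f g : ℝ → X} {a b : ℝ}
    (hf : AbsolutelyContinuousOnInterval f a b) (h : ∀ x ∈ uIcc a b, g x = f x) :
    AbsolutelyContinuousOnInterval g a b :=
  absolutelyContinuousOnInterval_of_dist_le hf fun x hx y hy => by rw [h x hx, h y hy]

theorem absolutelyContinuousOnInterval_comp_add {f : ℝ → Plane} {a b d : ℝ}
    (hf : AbsolutelyContinuousOnInterval f (a + d) (b + d)) :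
    AbsolutelyContinuousOnInterval (fun t => f (t + d)) a b := by
  have hi := intervalIntegrable_deriv_of_absolutelyContinuous hf
  refine absolutelyContinuousOnInterval_of_eq_primitive (g := fun t => deriv f (t + d))
    (by simpa using hi.comp_add_right d) fun x hx => ?_
  rw [intervalIntegral.integral_comp_add_right]
  refine eq_primitive_of_absolutelyContinuous hf ?_
  rcases le_total a b with h | h
  · rw [uIcc_of_le h] at hx; rw [uIcc_of_le (by linarith)]
    exact ⟨by linarith [hx.1], by linarith [hx.2]⟩
  · rw [uIcc_of_ge h] at hx; rw [uIcc_of_ge (by linarith)]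
    exact ⟨by linarith [hx.1], by linarith [hx.2]⟩

end AbsolutelyContinuous

end Quasipotential

namespace Quasipotential

/-! ### The Lagrangian and its integrals -/

/-- The integrand of the geometric action at position `x` and velocity `v`. -/
noncomputable def lagrangian (b : Plane → Plane) (x v : Plane) : ℝ :=
  ‖v‖ * ‖b x‖ - inner ℝ v (b x)

theorem lagrangian_nonneg (b : Plane → Plane) (x v : Plane) : 0 ≤ lagrangian b x v :=
  sub_nonneg.2 (real_inner_le_norm v (b x))

/-- Allows the drift to be frozen at a point `c`, with an error proportional to length. -/
theorem abs_lagrangian_sub_le (b : Plane → Plane) (x c v : Plane) :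
    |lagrangian b x v - lagrangian b c v| ≤ 2 * ‖b x - b c‖ * ‖v‖ := by
  have h1 := abs_norm_sub_norm_le (b x) (b c)
  have h2 := abs_real_inner_le_norm v (b x - b c)
  rw [inner_sub_right] at h2
  unfold lagrangian
  calc |‖v‖ * ‖b x‖ - inner ℝ v (b x) - (‖v‖ * ‖b c‖ - inner ℝ v (b c))|
      = |‖v‖ * (‖b x‖ - ‖b c‖) - (inner ℝ v (b x) - inner ℝ v (b c))| := by congr 1; ring
    _ ≤ |‖v‖ * (‖b x‖ - ‖b c‖)| + |inner ℝ v (b x) - inner ℝ v (b c)| := abs_sub _ _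
    _ ≤ ‖v‖ * ‖b x - b c‖ + ‖v‖ * ‖b x - b c‖ := by
        rw [abs_mul, abs_of_nonneg (norm_nonneg v)]; gcongr
    _ = _ := by ring

section

variable {b : Plane → Plane} (hb : Continuous b)
include hb

theorem intervalIntegrable_lagrangian {φ g : ℝ → Plane} {r s : ℝ} (hrs : r ≤ s)
    (hφ : ContinuousOn φ (Icc r s)) (hg : IntervalIntegrable g volume r s) :
    IntervalIntegrable (fun t => lagrangian b (φ t) (g t)) volume r s := by
  have hbφ : ContinuousOn (fun t => b (φ t)) (uIcc r s) := by
    rw [uIcc_of_le hrs]; exact hb.comp_continuousOn hφ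
  have h1 : IntervalIntegrable (fun t => ‖g t‖ * ‖b (φ t)‖) volume r s :=
    hg.norm.mul_continuousOn hbφ.norm
  refine h1.sub (h1.mono_fun ?_ ?_)
  · have hm : AEStronglyMeasurable (fun t => b (φ t)) (volume.restrict (uIoc r s)) :=
      (hbφ.mono uIoc_subset_uIcc).aestronglyMeasurable measurableSet_uIoc
    exact hg.aestronglyMeasurable_restrict_uIoc.inner hm
  · refine Eventually.of_forall fun t => ?_
    beta_reduce
    rw [Real.norm_eq_abs, Real.norm_eq_abs, abs_mul, abs_norm, abs_norm]
    exact abs_real_inner_le_norm _ _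

theorem lintegral_costRate_eq {φ : ℝ → Plane} {r s : ℝ} (hrs : r ≤ s)
    (hφ : AbsolutelyContinuousOnInterval φ r s) :
    ∫⁻ t in Ioc r s, costRate b φ t =
      ENNReal.ofReal (∫ t in r..s, lagrangian b (φ t) (deriv φ t)) := by
  have hc : ContinuousOn φ (Icc r s) := by have := hφ.continuousOn; rwa [uIcc_of_le hrs] at this
  have hi := intervalIntegrable_lagrangian hb hrs hc
    (intervalIntegrable_deriv_of_absolutelyContinuous hφ)
  rw [intervalIntegral.integral_of_le hrs, ofReal_integral_eq_lintegral_ofReal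
    ((intervalIntegrable_iff_integrableOn_Ioc_of_le hrs).1 hi)
    (Eventually.of_forall fun t => lagrangian_nonneg _ _ _)]
  rfl

omit hb in
-- Any competitor for `ψ r` can be continued by `ψ`, shifted in time so that the two pieces meet.
theorem quasipotential_le_add_lintegral {O : Plane} {ψ : ℝ → Plane} {r s : ℝ} (hrs : r < s)
    (hψ : AbsolutelyContinuousOnInterval ψ r s) :
    quasipotential b O (ψ s) ≤ quasipotential b O (ψ r) + ∫⁻ t in Ioc r s, costRate b ψ t := by
  conv_rhs => rw [quasipotential]
  simp only [ENNReal.iInf_add]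
  refine le_iInf fun L => le_iInf fun χ => le_iInf fun hL => le_iInf fun hcont =>
    le_iInf fun h0 => le_iInf fun hend => ?_
  by_cases hχ : AbsolutelyContinuousOnInterval χ 0 L
  swap
  · simp [geometricAction, hχ]
  set d : ℝ := r - L with hd
  set f : ℝ → Plane := fun t => if t ≤ L then χ t else ψ (t + d) with hf
  have hfl : ∀ t ≤ L, f t = χ t := fun t ht => if_pos ht
  have hfr : ∀ t, L ≤ t → f t = ψ (t + d) := fun t ht => by
    rcases ht.eq_or_lt with rfl | h
    · rw [hfl _ le_rfl, hend]; congr 1; rw [hd]; ring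
    · exact if_neg h.not_ge
  set M : ℝ := s - d with hM
  have hLM : L < M := by rw [hM, hd]; linarith
  have hac : AbsolutelyContinuousOnInterval f 0 M := by
    refine absolutelyContinuousOnInterval_trans hL.le hLM.le
      (absolutelyContinuousOnInterval_congr hχ fun x hx => ?_)
      (absolutelyContinuousOnInterval_congr
        (absolutelyContinuousOnInterval_comp_add (d := d) (f := ψ) ?_) fun x hx => ?_)
    · rw [uIcc_of_le hL.le] at hx; exact hfl x hx.2
    · convert! hψ using 1 <;> simp [hM, hd]
    · rw [uIcc_of_le hLM.le] at hx; exact hfr x hx.1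
  have hb' : ∀ c : ℝ, ∀ᵐ t : ℝ, t ≠ c := fun c => by simp [ae_iff, measure_singleton]
  have e1 : ∫⁻ t in Ioc 0 L, costRate b f t = ∫⁻ t in Ioc 0 L, costRate b χ t := by
    refine setLIntegral_congr_fun_ae measurableSet_Ioc ?_
    -- The glued path may fail to have the derivative of `χ` at the junction, a null set.
    filter_upwards [hb' L] with t ht htm
    have hlt : t < L := lt_of_le_of_ne htm.2 ht
    have he : f =ᶠ[𝓝 t] χ := by
      filter_upwards [Iio_mem_nhds hlt] with z hz using hfl z (le_of_lt hz)
    simp only [costRate]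
    rw [he.deriv_eq, hfl t htm.2]
  have e2 : ∫⁻ t in Ioc L M, costRate b f t = ∫⁻ t in Ioc r s, costRate b ψ t := by
    have h1 : ∫⁻ t in Ioc L M, costRate b f t = ∫⁻ t in Ioc L M, costRate b ψ (t + d) := by
      refine setLIntegral_congr_fun measurableSet_Ioc fun t htm => ?_
      have he : f =ᶠ[𝓝 t] fun z => ψ (z + d) := by
        filter_upwards [Ioi_mem_nhds htm.1] with z hz using hfr z (le_of_lt hz)
      simp only [costRate]
      rw [he.deriv_eq, hfr t htm.1.le, deriv_comp_add_const]
    rw [h1]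
    have h2 := (measurePreserving_add_right volume d).setLIntegral_comp_emb
      (measurableEmbedding_addRight d) (costRate b ψ) (Ioc L M)
    rw [h2]
    congr 2
    rw [image_add_const_Ioc, hM, hd]
    congr 1 <;> ring
  have hfM : f M = ψ s := by rw [hfr M hLM.le]; simp [hM]
  have hle : quasipotential b O (f M) ≤ geometricAction b M f := by
    refine iInf_le_of_le M <| iInf_le_of_le f <| iInf_le_of_le (hL.trans hLM) <|
      iInf_le_of_le ?_ <| iInf_le_of_le ?_ <| iInf_le_of_le rfl le_rfl
    · have := hac.continuousOn; rwa [uIcc_of_le (hL.trans hLM).le] at this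
    · rw [hfl 0 hL.le, h0]
  rw [hfM] at hle
  refine hle.trans ?_
  rw [geometricAction, if_pos hac, geometricAction, if_pos hχ,
    ← Ioc_union_Ioc_eq_Ioc hL.le hLM.le,
    lintegral_union measurableSet_Ioc (Ioc_disjoint_Ioc_of_le le_rfl), e1, e2]

omit hb in
theorem quasipotential_self (O : Plane) : quasipotential b O O = 0 := by
  refine le_antisymm ?_ bot_le
  refine iInf_le_of_le 1 <| iInf_le_of_le (fun _ => O) <| iInf_le_of_le one_pos <|
      iInf_le_of_le continuousOn_const <| iInf_le_of_le rfl <| iInf_le_of_le rfl ?_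
  have hac : AbsolutelyContinuousOnInterval (fun _ : ℝ => O) 0 1 :=
    ((LipschitzWith.const O).lipschitzOnWith (s := uIcc 0 1)).absolutelyContinuousOnInterval
  rw [geometricAction, if_pos hac]
  simp [costRate]

theorem quasipotential_le_add_ofReal {O : Plane} {ψ : ℝ → Plane} {r s : ℝ} (hrs : r < s)
    (hψ : AbsolutelyContinuousOnInterval ψ r s) :
    quasipotential b O (ψ s) ≤ quasipotential b O (ψ r) +
      ENNReal.ofReal (∫ t in r..s, lagrangian b (ψ t) (deriv ψ t)) := by
  rw [← lintegral_costRate_eq hb hrs.le hψ]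
  exact quasipotential_le_add_lintegral hrs hψ

/-- The comparison with a straight segment, with the drift frozen at `c`; it yields finiteness and
continuity at `O` of the quasipotential, and the first-order estimates near `y`. -/
theorem quasipotential_le_line {O x x' c : Plane} {η : ℝ}
    (h : ∀ z ∈ segment ℝ x x', ‖b z - b c‖ ≤ η) :
    quasipotential b O x' ≤ quasipotential b O x +
      ENNReal.ofReal (lagrangian b c (x' - x) + 2 * η * ‖x' - x‖) := by
  set ψ : ℝ → Plane := ⇑(AffineMap.lineMap x x' : ℝ →ᵃ[ℝ] Plane) with hψ
  have hcd : ContDiff ℝ 1 ψ := by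
    have : ψ = fun t => t • (x' - x) + x := funext fun t => AffineMap.lineMap_apply_module' x x' t
    rw [this]; fun_prop
  have hac : AbsolutelyContinuousOnInterval ψ 0 1 :=
    hcd.contDiffOn.absolutelyContinuousOnInterval
  have hd : ∀ t, deriv ψ t = x' - x := fun t => (AffineMap.hasDerivAt_lineMap (a := x) (b := x') (x := t)).deriv
  have hle := quasipotential_le_add_ofReal hb (O := O) one_pos hac
  have h0 : ψ 0 = x := by simp [hψ]
  have h1 : ψ 1 = x' := by simp [hψ]
  rw [h0, h1] at hle
  refine hle.trans ?_
  gcongr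
  have hm : ∀ t ∈ Icc (0 : ℝ) 1, lagrangian b (ψ t) (deriv ψ t) ≤
      lagrangian b c (x' - x) + 2 * η * ‖x' - x‖ := fun t ht => by
    rw [hd]
    have hz : ψ t ∈ segment ℝ x x' := by
      rw [segment_eq_image_lineMap]; exact ⟨t, ht, by rw [hψ]⟩
    have h2 := le_of_abs_le (abs_lagrangian_sub_le b (ψ t) c (x' - x))
    have h3 : 2 * ‖b (ψ t) - b c‖ * ‖x' - x‖ ≤ 2 * η * ‖x' - x‖ := by
      gcongr; exact h _ hz
    linarith
  have hc : ContinuousOn ψ (Icc 0 1) := by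
    have := hac.continuousOn; rwa [uIcc_of_le zero_le_one] at this
  have hi := intervalIntegrable_lagrangian hb zero_le_one hc
    (intervalIntegrable_deriv_of_absolutelyContinuous hac)
  have := intervalIntegral.integral_mono_on zero_le_one hi (intervalIntegrable_const
    (c := lagrangian b c (x' - x) + 2 * η * ‖x' - x‖)) hm
  simpa using this

theorem exists_bound_segment (x x' c : Plane) :
    ∃ η, ∀ z ∈ segment ℝ x x', ‖b z - b c‖ ≤ η := by
  have hk : IsCompact (segment ℝ x x') := by
    rw [segment_eq_image_lineMap]
    exact isCompact_Icc.image (AffineMap.lineMap_continuous)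
  exact hk.exists_bound_of_continuousOn (hb.sub continuous_const).continuousOn

theorem quasipotential_lt_top (O x : Plane) : quasipotential b O x < ⊤ := by
  obtain ⟨η, hη⟩ := exists_bound_segment hb O x O
  refine (quasipotential_le_line hb hη).trans_lt ?_
  rw [quasipotential_self, zero_add]
  exact ENNReal.ofReal_lt_top

theorem toReal_quasipotential_le_line {O x x' c : Plane} {η : ℝ}
    (h : ∀ z ∈ segment ℝ x x', ‖b z - b c‖ ≤ η) :
    (quasipotential b O x').toReal ≤ (quasipotential b O x).toReal +
      (lagrangian b c (x' - x) + 2 * η * ‖x' - x‖) := by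
  have hη : 0 ≤ η := (norm_nonneg _).trans (h x (left_mem_segment ℝ x x'))
  have hn : 0 ≤ lagrangian b c (x' - x) + 2 * η * ‖x' - x‖ :=
    add_nonneg (lagrangian_nonneg _ _ _) (by positivity)
  have h1 := ENNReal.toReal_mono (by
    simpa using (quasipotential_lt_top hb O x).ne) (quasipotential_le_line hb (O := O) h)
  rwa [ENNReal.toReal_add (quasipotential_lt_top hb O x).ne ENNReal.ofReal_ne_top,
    ENNReal.toReal_ofReal hn] at h1

theorem toReal_quasipotential_le_add_integral {O : Plane} {ψ : ℝ → Plane} {r s : ℝ} (hrs : r < s)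
    (hψ : AbsolutelyContinuousOnInterval ψ r s) :
    (quasipotential b O (ψ s)).toReal ≤ (quasipotential b O (ψ r)).toReal +
      ∫ t in r..s, lagrangian b (ψ t) (deriv ψ t) := by
  have hn : 0 ≤ ∫ t in r..s, lagrangian b (ψ t) (deriv ψ t) :=
    intervalIntegral.integral_nonneg hrs.le fun t _ => lagrangian_nonneg _ _ _
  have h1 := ENNReal.toReal_mono (by
    simpa using (quasipotential_lt_top hb O (ψ r)).ne)
    (quasipotential_le_add_ofReal hb (O := O) hrs hψ)
  rwa [ENNReal.toReal_add (quasipotential_lt_top hb O _).ne ENNReal.ofReal_ne_top,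
    ENNReal.toReal_ofReal hn] at h1

theorem tendsto_quasipotential_nhds (O : Plane) :
    Tendsto (quasipotential b O) (𝓝 O) (𝓝 0) := by
  obtain ⟨δ, hδ, hball⟩ := Metric.continuous_iff.1 hb O 1 one_pos
  have hbd : ∀ᶠ x in 𝓝 O, quasipotential b O x ≤
      ENNReal.ofReal (lagrangian b O (x - O) + 2 * 1 * ‖x - O‖) := by
    filter_upwards [Metric.ball_mem_nhds O hδ] with x hx
    refine (quasipotential_le_line hb (O := O) (x := O) (c := O) (η := 1) fun z hz => ?_).trans
      (by rw [quasipotential_self, zero_add])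
    have : z ∈ Metric.ball O δ :=
      (convex_ball O δ).segment_subset (Metric.mem_ball_self hδ) hx hz
    rw [← dist_eq_norm]; exact (hball z this).le
  have hlim : Tendsto (fun x => ENNReal.ofReal (lagrangian b O (x - O) + 2 * 1 * ‖x - O‖))
      (𝓝 O) (𝓝 0) := by
    have hc : Continuous fun x => ENNReal.ofReal (lagrangian b O (x - O) + 2 * 1 * ‖x - O‖) := by
      unfold lagrangian; exact ENNReal.continuous_ofReal.comp (by fun_prop)
    simpa [lagrangian] using hc.tendsto O
  exact tendsto_of_tendsto_of_tendsto_of_le_of_le' tendsto_const_nhds hlim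
    (Eventually.of_forall fun _ => zero_le) hbd

end

end Quasipotential

namespace Quasipotential

/-! ### Minimum action paths are calibrated by the quasipotential -/

section

variable {b : Plane → Plane} {O y : Plane} {L : ℝ} {φ : ℝ → Plane}

theorem IsMAP.absCont_sub (hφ : IsMAP b O y L φ) {r s : ℝ} (hr : 0 < r) (hrs : r ≤ s)
    (hs : s ≤ L) : AbsolutelyContinuousOnInterval φ r s := by
  rcases (hrs.trans hs).eq_or_lt with h | h
  · have hsr : s = r := le_antisymm (by linarith) hrs
    subst hsr
    have : LipschitzOnWith 0 φ (uIcc s s) := by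
      rw [uIcc_self]; intro x hx z hz
      rw [mem_singleton_iff.1 hx, mem_singleton_iff.1 hz]; simp
    exact this.absolutelyContinuousOnInterval
  · refine (hφ.absCont r ⟨hr, h⟩).mono ?_
    rw [uIcc_of_le hrs, uIcc_of_le h.le]
    exact Icc_subset_Icc_right hs

variable (hb : Continuous b)
include hb

/-- Every initial piece is optimal: a cheaper way to `φ t`, continued along the path, would beat the
action of the whole. -/
theorem IsMAP.quasipotential_eq (hφ : IsMAP b O y L φ) {t : ℝ} (ht : t ∈ Ioc 0 L) :
    quasipotential b O (φ t) = ∫⁻ r in Ioc 0 t, costRate b φ r := by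
  have hle : ∀ s ∈ Ioc 0 L, quasipotential b O (φ s) ≤ ∫⁻ r in Ioc 0 s, costRate b φ r := by
    intro s hs
    -- The path need not be absolutely continuous up to time 0, so it is not itself a competitor. It
    -- is entered at time `ε`, at a cost that tends to 0.
    have hlim : Tendsto (fun ε => quasipotential b O (φ ε) + ∫⁻ r in Ioc 0 s, costRate b φ r)
        (𝓝[>] 0) (𝓝 (0 + ∫⁻ r in Ioc 0 s, costRate b φ r)) := by
      refine Tendsto.add ((tendsto_quasipotential_nhds hb O).comp ?_) tendsto_const_nhds
      have h1 := (hφ.continuousOn 0 ⟨le_rfl, hφ.pos.le⟩).mono_left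
        (nhdsWithin_le_of_mem (Icc_mem_nhdsGT hφ.pos))
      rwa [hφ.start] at h1
    rw [zero_add] at hlim
    refine ge_of_tendsto hlim ?_
    filter_upwards [Ioo_mem_nhdsGT hs.1] with ε hε
    refine (quasipotential_le_add_lintegral hε.2 (hφ.absCont_sub hε.1 hε.2.le hs.2)).trans ?_
    gcongr
    exact hε.1.le
  refine le_antisymm (hle t ht) ?_
  rcases ht.2.eq_or_lt with rfl | hlt
  · rw [hφ.action_eq, hφ.finish]
  have h1 := quasipotential_le_add_lintegral (b := b) (O := O) hlt (hφ.absCont_sub ht.1 hlt.le le_rfl)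
  rw [hφ.finish, ← hφ.action_eq, ← Ioc_union_Ioc_eq_Ioc ht.1.le ht.2,
    lintegral_union measurableSet_Ioc (Ioc_disjoint_Ioc_of_le le_rfl)] at h1
  have hfin : ∫⁻ r in Ioc t L, costRate b φ r ≠ ⊤ := by
    refine ne_top_of_le_ne_top (quasipotential_lt_top hb O y).ne ?_
    rw [← hφ.action_eq]
    exact lintegral_mono_set (Ioc_subset_Ioc_left ht.1.le)
  exact (ENNReal.add_le_add_iff_right hfin).1 h1

theorem IsMAP.of_le (hφ : IsMAP b O y L φ) {t : ℝ} (ht : t ∈ Ioc 0 L) :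
    IsMAP b O (φ t) t φ where
  pos := ht.1
  continuousOn := hφ.continuousOn.mono (Icc_subset_Icc_right ht.2)
  start := hφ.start
  finish := rfl
  absCont := fun _ hε => hφ.absCont_sub hε.1 hε.2.le ht.2
  action_eq := (hφ.quasipotential_eq hb ht).symm

theorem IsMAP.toReal_quasipotential_eq (hφ : IsMAP b O y L φ) {r s : ℝ} (hr : 0 < r) (hrs : r ≤ s)
    (hs : s ≤ L) : (quasipotential b O (φ s)).toReal = (quasipotential b O (φ r)).toReal +
      ∫ t in r..s, lagrangian b (φ t) (deriv φ t) := by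
  have h1 := hφ.quasipotential_eq hb (t := s) ⟨hr.trans_le hrs, hs⟩
  rw [← Ioc_union_Ioc_eq_Ioc hr.le hrs,
    lintegral_union measurableSet_Ioc (Ioc_disjoint_Ioc_of_le le_rfl),
    ← hφ.quasipotential_eq hb ⟨hr, hrs.trans hs⟩,
    lintegral_costRate_eq hb hrs (hφ.absCont_sub hr hrs hs)] at h1
  rw [h1, ENNReal.toReal_add (quasipotential_lt_top hb O _).ne ENNReal.ofReal_ne_top,
    ENNReal.toReal_ofReal]
  exact intervalIntegral.integral_nonneg hrs fun t _ => lagrangian_nonneg _ _ _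

end

/-! ### First variation -/

/-- The momentum of the path `φ`, times its speed; it vanishes where `φ` follows the flow. -/
noncomputable def momentum (b : Plane → Plane) (φ : ℝ → Plane) (t : ℝ) : Plane :=
  ‖b (φ t)‖ • deriv φ t - ‖deriv φ t‖ • b (φ t)

/-- From `2‖x‖‖x + d‖ ≤ ‖x‖² + ‖x + d‖²`. -/
theorem norm_add_le_first_order {E : Type*} [NormedAddCommGroup E] [InnerProductSpace ℝ E]
    {x : E} (hx : x ≠ 0) (d : E) :
    ‖x + d‖ ≤ ‖x‖ + inner ℝ x d / ‖x‖ + ‖d‖ ^ 2 / (2 * ‖x‖) := by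
  have hn : 0 < ‖x‖ := norm_pos_iff.2 hx
  set u := (2 * ‖x‖ ^ 2 + 2 * inner ℝ x d + ‖d‖ ^ 2) with hu
  have h1 : ‖x + d‖ ^ 2 = ‖x‖ ^ 2 + 2 * inner ℝ x d + ‖d‖ ^ 2 := norm_add_sq_real x d
  have h2 : ‖x‖ + inner ℝ x d / ‖x‖ + ‖d‖ ^ 2 / (2 * ‖x‖) = u / (2 * ‖x‖) := by
    rw [hu]; field_simp
  rw [h2, le_div_iff₀ (by positivity)]
  nlinarith [sq_nonneg (‖x + d‖ - ‖x‖)]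

/-- Both norms in the Lagrangian are expanded to first order. The velocity change is taken
proportional to `‖v‖`, so that the second-order remainder integrates to a multiple of the length. -/
theorem lagrangian_perturb {b : Plane → Plane} {x x' v q : Plane} {β M a k ε : ℝ} (hβ : 0 < β)
    (hβx : β ≤ ‖b x‖) (hM : ‖b x‖ ≤ M) (hε : 0 ≤ ε) (hε1 : ε ≤ 1) (hq : ‖q‖ ≤ ε * a)
    (hΔ : ‖b x' - b x‖ ≤ ε * k) (ha : 0 ≤ a) (hk : 0 ≤ k) :
    lagrangian b x' (v + ‖v‖ • q) ≤ lagrangian b x v + inner ℝ (‖b x‖ • v - ‖v‖ • b x) q +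
      ε * (k / β * ‖‖b x‖ • v - ‖v‖ • b x‖) +
      ε ^ 2 * ((M * a ^ 2 / 2 + k ^ 2 / (2 * β) + (a + a ^ 2 / 2) * (k + k ^ 2 / (2 * β)) + a * k)
        * ‖v‖) := by
  rcases eq_or_ne v 0 with rfl | hv
  · simp [lagrangian]
  have hn : 0 < ‖v‖ := norm_pos_iff.2 hv
  have hm : 0 < ‖b x‖ := hβ.trans_le hβx
  have hbx : b x ≠ 0 := norm_pos_iff.1 hm
  set Δ := b x' - b x with hΔd
  have hx' : b x' = b x + Δ := by rw [hΔd]; abel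
  have hX := norm_add_le_first_order hv (‖v‖ • q)
  have hY := norm_add_le_first_order hbx Δ
  rw [inner_smul_right, norm_smul, norm_norm] at hX
  set n := ‖v‖ with hnd
  set m := ‖b x‖ with hmd
  set α := inner ℝ v q with hα
  set γ := inner ℝ (b x) Δ with hγ
  set w := ‖q‖ with hw
  set δ := ‖Δ‖ with hδ
  have hw0 : 0 ≤ w := norm_nonneg _
  have hδ0 : 0 ≤ δ := norm_nonneg _
  have hαb : |α| ≤ n * w := abs_real_inner_le_norm v q
  have hγb : |γ| ≤ m * δ := abs_real_inner_le_norm (b x) Δ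
  set A := α + n * w ^ 2 / 2 with hA
  set B := γ / m + δ ^ 2 / (2 * m) with hB
  have hX' : ‖v + n • q‖ ≤ n + A := by
    refine hX.trans (le_of_eq ?_); rw [hA]; field_simp; ring
  have hY' : ‖b x + Δ‖ ≤ m + B := by
    refine hY.trans (le_of_eq ?_); rw [hB]; ring
  have hAb : |A| ≤ n * (ε * (a + a ^ 2 / 2)) := by
    have h1 : |A| ≤ n * w + n * w ^ 2 / 2 := by
      rw [hA]; refine (abs_add_le _ _).trans ?_
      rw [abs_of_nonneg (by positivity : 0 ≤ n * w ^ 2 / 2)]; linarith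
    have h2 : w ^ 2 ≤ ε * a ^ 2 := by
      calc w ^ 2 ≤ (ε * a) ^ 2 := by gcongr
        _ = ε * (ε * a ^ 2) := by ring
        _ ≤ ε * (1 * a ^ 2) := by gcongr
        _ = _ := by ring
    calc |A| ≤ n * (w + w ^ 2 / 2) := by linarith
      _ ≤ n * (ε * a + ε * a ^ 2 / 2) := by gcongr
      _ = _ := by ring
  have hδ2 : δ ^ 2 ≤ ε ^ 2 * k ^ 2 := by rw [← mul_pow]; gcongr
  have hBb : |B| ≤ ε * (k + k ^ 2 / (2 * β)) := by
    have h1 : |B| ≤ δ + δ ^ 2 / (2 * m) := by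
      rw [hB]; refine (abs_add_le _ _).trans ?_
      rw [abs_of_nonneg (by positivity : 0 ≤ δ ^ 2 / (2 * m)), abs_div, abs_of_pos hm]
      gcongr; rw [div_le_iff₀ hm]; linarith
    have h2 : δ ^ 2 / (2 * m) ≤ ε * k ^ 2 / (2 * β) := by
      gcongr
      calc δ ^ 2 ≤ ε ^ 2 * k ^ 2 := hδ2
        _ = ε * (ε * k ^ 2) := by ring
        _ ≤ ε * (1 * k ^ 2) := by gcongr
        _ = _ := by ring
    calc |B| ≤ ε * k + ε * k ^ 2 / (2 * β) := by linarith
      _ = _ := by ring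
  have hAB : A * B ≤ ε ^ 2 * ((a + a ^ 2 / 2) * (k + k ^ 2 / (2 * β)) * n) := by
    calc A * B ≤ |A| * |B| := by rw [← abs_mul]; exact le_abs_self _
      _ ≤ n * (ε * (a + a ^ 2 / 2)) * (ε * (k + k ^ 2 / (2 * β))) := by gcongr
      _ = _ := by ring
  have hprod : ‖v + n • q‖ * ‖b x + Δ‖ ≤ (n + A) * (m + B) :=
    mul_le_mul hX' hY' (norm_nonneg _) ((norm_nonneg _).trans hX')
  have hqΔ : -(n * inner ℝ q Δ) ≤ ε ^ 2 * (a * k * n) := by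
    have h1 := neg_le_of_abs_le (abs_real_inner_le_norm q Δ)
    have h2 : ‖q‖ * ‖Δ‖ ≤ (ε * a) * (ε * k) := by gcongr
    nlinarith
  -- The key cancellation: the first-order effect of changing the drift is the pairing of the
  -- momentum with `Δ`, divided by `-‖b x‖`. It is therefore small where the momentum is.
  have hPΔ : n * γ / m - inner ℝ v Δ ≤ ε * (k / β * ‖m • v - n • b x‖) := by
    have h1 : n * γ / m - inner ℝ v Δ = -(inner ℝ (m • v - n • b x) Δ) / m := by
      rw [inner_sub_left, inner_smul_left, inner_smul_left, hγ]
      simp only [conj_trivial]; field_simp; ring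
    have h2 := neg_le_of_abs_le (abs_real_inner_le_norm (m • v - n • b x) Δ)
    rw [h1]
    calc -(inner ℝ (m • v - n • b x) Δ) / m ≤ (‖m • v - n • b x‖ * ‖Δ‖) / m := by gcongr; linarith
      _ ≤ (‖m • v - n • b x‖ * (ε * k)) / β := by gcongr
      _ = _ := by ring
  have hq1 : n * (δ ^ 2 / (2 * m)) ≤ ε ^ 2 * (k ^ 2 / (2 * β) * n) := by
    calc n * (δ ^ 2 / (2 * m)) ≤ n * (ε ^ 2 * k ^ 2 / (2 * β)) := by gcongr
      _ = _ := by ring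
  have hq2 : m * (n * w ^ 2 / 2) ≤ ε ^ 2 * (M * a ^ 2 / 2 * n) := by
    have hM0 : 0 ≤ M := hm.le.trans hM
    calc m * (n * w ^ 2 / 2) ≤ M * (n * (ε * a) ^ 2 / 2) := by gcongr
      _ = _ := by ring
  have hin : inner ℝ (v + n • q) (b x + Δ) = inner ℝ v (b x) + inner ℝ v Δ +
      n * inner ℝ (b x) q + n * inner ℝ q Δ := by
    simp only [inner_add_left, inner_add_right, inner_smul_left, conj_trivial,
      real_inner_comm (b x) q]
    ring
  have hin2 : inner ℝ (m • v - n • b x) q = m * α - n * inner ℝ (b x) q := by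
    rw [inner_sub_left, inner_smul_left, inner_smul_left]; simp only [conj_trivial, hα]
  have hexp : (n + A) * (m + B) = n * m + n * γ / m + n * (δ ^ 2 / (2 * m)) + m * α +
      m * (n * w ^ 2 / 2) + A * B := by
    rw [hA, hB]; ring
  unfold lagrangian
  rw [hx', hin, hin2]
  linarith
end Quasipotential

/-! ### Integrated first variation and averages of the momentum -/

namespace Quasipotential

section

variable {b : Plane → Plane} (hb : Continuous b) {φ : ℝ → Plane}
include hb

theorem intervalIntegrable_momentum {r s : ℝ}
    (hφ : AbsolutelyContinuousOnInterval φ r s) :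
    IntervalIntegrable (momentum b φ) volume r s := by
  have hc : ContinuousOn (fun t => b (φ t)) (uIcc r s) := hb.comp_continuousOn hφ.continuousOn
  have hi := intervalIntegrable_deriv_of_absolutelyContinuous hφ
  exact (hi.continuousOn_smul hc.norm).sub (hi.norm.smul_continuousOn hc)

/-- The displacement in direction `e` is affine in arc length, so its velocity is `εκ‖φ'‖e` and
`lagrangian_perturb` applies pointwise with `a = |κ|` and `k = K`. The bound by 1 on the profile
keeps the perturbed path in the ball where `b` is Lipschitz. -/
theorem first_variation {K : ℝ≥0} {R β M : ℝ} (hK : LipschitzOnWith K b (Metric.closedBall 0 R))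
    {r s : ℝ} (hrs : r ≤ s) (hφ : AbsolutelyContinuousOnInterval φ r s)
    (hR : ∀ t ∈ Icc r s, ‖φ t‖ ≤ R - 1) (hβ : 0 < β) (hβφ : ∀ t ∈ Icc r s, β ≤ ‖b (φ t)‖)
    (hM : ∀ t ∈ Icc r s, ‖b (φ t)‖ ≤ M) {e : Plane} (he : ‖e‖ = 1) {c₀ κ : ℝ}
    (hc : ∀ t ∈ Icc r s, |c₀ + κ * ∫ z in r..t, ‖deriv φ z‖| ≤ 1) :
    ∃ C, ∀ ε ∈ Icc (0 : ℝ) 1, ∃ ψ : ℝ → Plane, AbsolutelyContinuousOnInterval ψ r s ∧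
      (∀ t, ψ t = φ t + (ε * (c₀ + κ * ∫ z in r..t, ‖deriv φ z‖)) • e) ∧
      ∫ t in r..s, lagrangian b (ψ t) (deriv ψ t) ≤
        (∫ t in r..s, lagrangian b (φ t) (deriv φ t)) +
        ε * (κ * inner ℝ (∫ t in r..s, momentum b φ t) e +
          K / β * ∫ t in r..s, ‖momentum b φ t‖) + ε ^ 2 * C := by
  have hi := intervalIntegrable_deriv_of_absolutelyContinuous hφ
  have hP := intervalIntegrable_momentum hb hφ
  set C₀ : ℝ := M * |κ| ^ 2 / 2 + K ^ 2 / (2 * β) + (|κ| + |κ| ^ 2 / 2) * (K + K ^ 2 / (2 * β)) +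
    |κ| * K with hC₀
  refine ⟨C₀ * ∫ t in r..s, ‖deriv φ t‖, fun ε hε =>
    ⟨fun t => φ t + (ε * (c₀ + κ * ∫ z in r..t, ‖deriv φ z‖)) • e, ?_, fun t => rfl, ?_⟩⟩
  · refine hφ.fun_add ?_
    refine absolutelyContinuousOnInterval_of_eq_primitive
      (g := fun t => (ε * κ * ‖deriv φ t‖) • e) ((hi.norm.const_mul _).smul_continuousOn continuousOn_const) fun x _ => ?_
    rw [intervalIntegral.integral_smul_const, intervalIntegral.integral_const_mul,
      intervalIntegral.integral_same, ← add_smul]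
    congr 1; ring
  set ψ : ℝ → Plane := fun t => φ t + (ε * (c₀ + κ * ∫ z in r..t, ‖deriv φ z‖)) • e with hψ
  have hψac : ContinuousOn ψ (Icc r s) := by
    have h1 : ContinuousOn (fun t => ∫ z in r..t, ‖deriv φ z‖) (Icc r s) := by
      have := (absolutelyContinuousOnInterval_primitive hi.norm).continuousOn
      rwa [uIcc_of_le hrs] at this
    have h2 := hφ.continuousOn
    rw [uIcc_of_le hrs] at h2
    rw [hψ]; fun_prop
  have hd : ∀ᵐ t, t ∈ Ioc r s → deriv ψ t = deriv φ t + ‖deriv φ t‖ • ((ε * κ) • e) := by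
    filter_upwards [ae_differentiableAt_of_absolutelyContinuous hφ,
      hi.norm.ae_hasDerivAt_integral] with t h1 h2 ht
    have htm : t ∈ uIcc r s := by rw [uIcc_of_le hrs]; exact Ioc_subset_Icc_self ht
    have h3 := (h1 htm).hasDerivAt.fun_add
      (((((h2 htm r left_mem_uIcc).const_mul κ).const_add c₀).const_mul ε).smul_const e)
    rw [h3.deriv, smul_smul]
    congr 2; ring
  have hψi : IntervalIntegrable (fun t => lagrangian b (ψ t)
      (deriv φ t + ‖deriv φ t‖ • ((ε * κ) • e))) volume r s :=
    intervalIntegrable_lagrangian hb hrs hψac (hi.add (hi.norm.smul_continuousOn continuousOn_const))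
  have hcongr : ∫ t in r..s, lagrangian b (ψ t) (deriv ψ t) =
      ∫ t in r..s, lagrangian b (ψ t) (deriv φ t + ‖deriv φ t‖ • ((ε * κ) • e)) := by
    refine intervalIntegral.integral_congr_ae ?_
    rw [uIoc_of_le hrs]
    filter_upwards [hd] with t ht htm
    rw [ht htm]
  have hφc : ContinuousOn φ (Icc r s) := by have := hφ.continuousOn; rwa [uIcc_of_le hrs] at this
  have i1 := intervalIntegrable_lagrangian hb hrs hφc hi
  have i2 : IntervalIntegrable (fun t => inner ℝ (momentum b φ t) ((ε * κ) • e)) volume r s :=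
    ⟨hP.1.inner_const _, hP.2.inner_const _⟩
  have i3 : IntervalIntegrable (fun t => ε * (K / β * ‖momentum b φ t‖)) volume r s :=
    (hP.norm.const_mul _).const_mul _
  have i4 : IntervalIntegrable (fun t => ε ^ 2 * (C₀ * ‖deriv φ t‖)) volume r s :=
    (hi.norm.const_mul _).const_mul _
  have hmono := intervalIntegral.integral_mono_on hrs hψi (((i1.add i2).add i3).add i4)
    fun t ht => by
      have hq : ‖(ε * κ) • e‖ ≤ ε * |κ| := by
        rw [norm_smul, he, mul_one, Real.norm_eq_abs, abs_mul, abs_of_nonneg hε.1]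
      have hdisp : ‖ψ t - φ t‖ ≤ ε := by
        simp only [hψ, add_sub_cancel_left]
        rw [norm_smul, he, mul_one, Real.norm_eq_abs, abs_mul, abs_of_nonneg hε.1]
        exact mul_le_of_le_one_right hε.1 (hc t ht)
      have hm1 : φ t ∈ Metric.closedBall (0 : Plane) R := by
        rw [mem_closedBall_zero_iff]; linarith [hR t ht]
      have hm2 : ψ t ∈ Metric.closedBall (0 : Plane) R := by
        rw [mem_closedBall_zero_iff]
        have : ‖ψ t‖ ≤ ‖φ t‖ + ‖ψ t - φ t‖ := by
          simpa using norm_add_le (φ t) (ψ t - φ t)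
        linarith [hR t ht, hε.2]
      have hΔ : ‖b (ψ t) - b (φ t)‖ ≤ ε * K := by
        refine (hK.norm_sub_le hm2 hm1).trans ?_
        rw [mul_comm]; gcongr
      exact lagrangian_perturb (v := deriv φ t) hβ (hβφ t ht) (hM t ht) hε.1 hε.2 hq hΔ
        (abs_nonneg κ) K.2
  rw [hcongr]
  refine hmono.trans (le_of_eq ?_)
  rw [intervalIntegral.integral_add ((i1.add i2).add i3) i4,
    intervalIntegral.integral_add (i1.add i2) i3, intervalIntegral.integral_add i1 i2,
    intervalIntegral.integral_const_mul, intervalIntegral.integral_const_mul,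
    intervalIntegral.integral_const_mul, intervalIntegral.integral_const_mul]
  have hin : ∫ t in r..s, inner ℝ (momentum b φ t) ((ε * κ) • e) =
      ε * κ * inner ℝ (∫ t in r..s, momentum b φ t) e := by
    have h1 := (innerSL ℝ ((ε * κ) • e)).intervalIntegral_comp_comm hP
    simp only [innerSL_apply_apply] at h1
    simp only [real_inner_comm ((ε * κ) • e)]
    rw [h1, inner_smul_left, real_inner_comm]; simp
  rw [hin]; ring

/-- An approximate conservation law. The path is displaced by a tent that rises linearly in arc
length on `[r, s]` and falls on `[s, q]`, with both ends fixed. Minimality makes the first-order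
change of action nonnegative for every direction `e`. -/
theorem norm_average_momentum_sub_le {O y : Plane} {L : ℝ} (hmap : IsMAP b O y L φ)
    {K : ℝ≥0} {R β : ℝ} (hK : LipschitzOnWith K b (Metric.closedBall 0 R))
    {r s q : ℝ} (hr : 0 < r) (hrs : r < s) (hsq : s < q) (hq : q ≤ L)
    (hR : ∀ t ∈ Icc r q, ‖φ t‖ ≤ R - 1) (hβ : 0 < β) (hβφ : ∀ t ∈ Icc r q, β ≤ ‖b (φ t)‖)
    (hl₁ : 0 < ∫ t in r..s, ‖deriv φ t‖) (hl₂ : 0 < ∫ t in s..q, ‖deriv φ t‖) :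
    ‖(∫ t in r..s, ‖deriv φ t‖)⁻¹ • (∫ t in r..s, momentum b φ t) -
      (∫ t in s..q, ‖deriv φ t‖)⁻¹ • (∫ t in s..q, momentum b φ t)‖ ≤
      K / β * ∫ t in r..q, ‖momentum b φ t‖ := by
  have hac := hmap.absCont_sub hr (hrs.trans hsq).le hq
  have hac₁ := hmap.absCont_sub hr hrs.le (hsq.le.trans hq)
  have hac₂ := hmap.absCont_sub (hr.trans hrs) hsq.le hq
  have hc : ContinuousOn φ (Icc r q) := by
    have := hac.continuousOn; rwa [uIcc_of_le (hrs.trans hsq).le] at this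
  obtain ⟨M, hM⟩ := isCompact_Icc.exists_bound_of_continuousOn (hb.comp_continuousOn hc)
  simp only [Function.comp_apply] at hM
  set l₁ := ∫ t in r..s, ‖deriv φ t‖ with hl₁d
  set l₂ := ∫ t in s..q, ‖deriv φ t‖ with hl₂d
  set J := l₁⁻¹ • (∫ t in r..s, momentum b φ t) - l₂⁻¹ • (∫ t in s..q, momentum b φ t) with hJ
  set A := ∫ t in r..q, ‖momentum b φ t‖ with hA
  have hsub₁ : Icc r s ⊆ Icc r q := Icc_subset_Icc_right hsq.le
  have hsub₂ : Icc s q ⊆ Icc r q := Icc_subset_Icc_left hrs.le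
  have hpart : ∀ {u v w : ℝ}, u ≤ v → v ≤ w → AbsolutelyContinuousOnInterval φ u w →
      0 ≤ ∫ t in u..v, ‖deriv φ t‖ ∧
        ∫ t in u..v, ‖deriv φ t‖ ≤ ∫ t in u..w, ‖deriv φ t‖ := by
    intro u v w huv hvw h
    refine ⟨intervalIntegral.integral_nonneg huv fun _ _ => norm_nonneg _, ?_⟩
    exact intervalIntegral.integral_mono_interval le_rfl huv hvw
      (Eventually.of_forall fun _ => norm_nonneg _)
      (intervalIntegrable_deriv_of_absolutelyContinuous h).norm
  have key : ∀ e : Plane, ‖e‖ = 1 → 0 ≤ inner ℝ J e + K / β * A := by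
    intro e he
    -- The slopes `l₁⁻¹` and `-l₂⁻¹` make the profile go from 0 to 1 and back to 0; they turn the
    -- momentum integrals into averages.
    obtain ⟨C₁, h₁⟩ := first_variation hb hK hrs.le hac₁ (fun t ht => hR t (hsub₁ ht)) hβ
      (fun t ht => hβφ t (hsub₁ ht)) (fun t ht => hM t (hsub₁ ht)) he (c₀ := 0) (κ := l₁⁻¹)
      (fun t ht => by
        obtain ⟨h1, h2⟩ := hpart ht.1 ht.2 hac₁
        rw [zero_add, abs_of_nonneg (by positivity), inv_mul_le_iff₀ hl₁]
        simpa using h2)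
    obtain ⟨C₂, h₂⟩ := first_variation hb hK hsq.le hac₂ (fun t ht => hR t (hsub₂ ht)) hβ
      (fun t ht => hβφ t (hsub₂ ht)) (fun t ht => hM t (hsub₂ ht)) he (c₀ := 1) (κ := -l₂⁻¹)
      (fun t ht => by
        obtain ⟨h1, h2⟩ := hpart ht.1 ht.2 hac₂
        have h3 : l₂⁻¹ * ∫ z in s..t, ‖deriv φ z‖ ≤ 1 := by
          rw [inv_mul_le_iff₀ hl₂]; simpa using h2
        have h4 : 0 ≤ l₂⁻¹ * ∫ z in s..t, ‖deriv φ z‖ := by positivity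
        rw [abs_le]; constructor <;> linarith)
    have hcal := hmap.toReal_quasipotential_eq hb hr (hrs.trans hsq).le hq
    have hφc : ∀ {u v}, u ≤ v → AbsolutelyContinuousOnInterval φ u v →
        IntervalIntegrable (fun t => lagrangian b (φ t) (deriv φ t)) volume u v := fun huv h =>
      intervalIntegrable_lagrangian hb huv (by
        have := h.continuousOn; rwa [uIcc_of_le huv] at this)
        (intervalIntegrable_deriv_of_absolutelyContinuous h)
    rw [← intervalIntegral.integral_add_adjacent_intervals (hφc hrs.le hac₁)
      (hφc hsq.le hac₂)] at hcal
    have hAsum : A = (∫ t in r..s, ‖momentum b φ t‖) + ∫ t in s..q, ‖momentum b φ t‖ :=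
      (intervalIntegral.integral_add_adjacent_intervals (intervalIntegrable_momentum hb hac₁).norm
        (intervalIntegrable_momentum hb hac₂).norm).symm
    have hJe : inner ℝ J e = l₁⁻¹ * inner ℝ (∫ t in r..s, momentum b φ t) e +
        -l₂⁻¹ * inner ℝ (∫ t in s..q, momentum b φ t) e := by
      rw [hJ, inner_sub_left, inner_smul_left, inner_smul_left]
      simp only [conj_trivial]; ring
    have hε : ∀ ε ∈ Ioc (0 : ℝ) 1, 0 ≤ inner ℝ J e + K / β * A + ε * (C₁ + C₂) := by
      intro ε hε
      obtain ⟨ψ₁, hψ₁, e₁, i₁⟩ := h₁ ε (Ioc_subset_Icc_self hε)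
      obtain ⟨ψ₂, hψ₂, e₂, i₂⟩ := h₂ ε (Ioc_subset_Icc_self hε)
      have j₁ := toReal_quasipotential_le_add_integral hb (O := O) hrs hψ₁
      have j₂ := toReal_quasipotential_le_add_integral hb (O := O) hsq hψ₂
      have k₁ : ψ₁ r = φ r := by rw [e₁]; simp
      have k₂ : ψ₁ s = φ s + ε • e := by
        rw [e₁, ← hl₁d, zero_add, inv_mul_cancel₀ hl₁.ne', mul_one]
      have k₃ : ψ₂ s = φ s + ε • e := by rw [e₂]; simp
      have k₄ : ψ₂ q = φ q := by
        rw [e₂, ← hl₂d, neg_mul, inv_mul_cancel₀ hl₂.ne']; simp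
      rw [k₁, k₂] at j₁
      rw [k₃, k₄] at j₂
      have : 0 ≤ ε * (inner ℝ J e + K / β * A + ε * (C₁ + C₂)) := by
        rw [hJe, hAsum]; linarith
      exact nonneg_of_mul_nonneg_right this hε.1
    have hlim : Tendsto (fun ε : ℝ => inner ℝ J e + K / β * A + ε * (C₁ + C₂)) (𝓝[>] 0)
        (𝓝 (inner ℝ J e + K / β * A + 0 * (C₁ + C₂))) :=
      ((continuous_const.add (continuous_id.mul continuous_const)).tendsto 0).mono_left
        nhdsWithin_le_nhds
    rw [zero_mul, add_zero] at hlim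
    refine ge_of_tendsto hlim ?_
    filter_upwards [Ioc_mem_nhdsGT (zero_lt_one (α := ℝ))] with ε h using hε ε h
  rcases eq_or_ne J 0 with h0 | h0
  · rw [h0, norm_zero]
    refine mul_nonneg (by positivity) (intervalIntegral.integral_nonneg (hrs.trans hsq).le
      fun _ _ => norm_nonneg _)
  · have hn : 0 < ‖J‖ := norm_pos_iff.2 h0
    -- The direction opposite to `J` gives the strongest inequality.
    have := key (-(‖J‖⁻¹ • J)) (by rw [norm_neg, norm_smul, norm_inv, norm_norm, inv_mul_cancel₀ hn.ne'])
    rw [inner_neg_right, inner_smul_right, real_inner_self_eq_norm_sq] at this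
    have h1 : ‖J‖⁻¹ * ‖J‖ ^ 2 = ‖J‖ := by field_simp
    linarith

end

end Quasipotential

namespace Quasipotential

/-! ### The length of a path -/

/-- The length of the path `φ` between the times `r` and `s`. -/
noncomputable def pathLength (φ : ℝ → Plane) (r s : ℝ) : ℝ := ∫ t in r..s, ‖deriv φ t‖

theorem pathLength_nonneg (φ : ℝ → Plane) {r s : ℝ} (hrs : r ≤ s) : 0 ≤ pathLength φ r s :=
  intervalIntegral.integral_nonneg hrs fun _ _ => norm_nonneg _

section

variable {φ : ℝ → Plane} {r s q : ℝ}

theorem pathLength_add (hφ : AbsolutelyContinuousOnInterval φ r q) (hrs : r ≤ s) (hsq : s ≤ q) :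
    pathLength φ r s + pathLength φ s q = pathLength φ r q := by
  have hi := (intervalIntegrable_deriv_of_absolutelyContinuous hφ).norm
  have hm : s ∈ uIcc r q := by rw [uIcc_of_le (hrs.trans hsq)]; exact ⟨hrs, hsq⟩
  exact intervalIntegral.integral_add_adjacent_intervals
    (hi.mono_set (uIcc_subset_uIcc_left hm)) (hi.mono_set (uIcc_subset_uIcc_right hm))

theorem norm_sub_le_pathLength (hφ : AbsolutelyContinuousOnInterval φ r s) (hrs : r ≤ s) :
    ‖φ s - φ r‖ ≤ pathLength φ r s := by
  rw [← integral_deriv_of_absolutelyContinuous hφ]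
  exact intervalIntegral.norm_integral_le_integral_norm hrs

theorem norm_sub_le_pathLength_of_mem (hφ : AbsolutelyContinuousOnInterval φ r s) {t : ℝ}
    (ht : t ∈ Icc r s) : ‖φ t - φ s‖ ≤ pathLength φ r s := by
  have h1 : AbsolutelyContinuousOnInterval φ t s := hφ.mono (by
    rw [uIcc_of_le ht.2, uIcc_of_le (ht.1.trans ht.2)]; exact Icc_subset_Icc_left ht.1)
  have h2 := norm_sub_le_pathLength h1 ht.2
  have h3 := pathLength_add hφ ht.1 ht.2
  have h4 := pathLength_nonneg φ ht.1
  rw [norm_sub_rev]; linarith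

theorem continuousOn_integral_left {E : Type*} [NormedAddCommGroup E] [NormedSpace ℝ E]
    {f : ℝ → E} {a c : ℝ} (hac : a ≤ c)
    (hf : IntervalIntegrable f volume a c) :
    ContinuousOn (fun t => ∫ z in t..c, f z) (Icc a c) := by
  have h1 : ContinuousOn (fun t => ∫ z in c..t, f z) (uIcc c a) :=
    (absolutelyContinuousOnInterval_primitive hf.symm).continuousOn
  rw [uIcc_of_ge hac] at h1
  refine h1.neg.congr fun t _ => ?_
  exact intervalIntegral.integral_symm c t

theorem tendsto_integral_left {E : Type*} [NormedAddCommGroup E] [NormedSpace ℝ E]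
    {f : ℝ → E} {a c : ℝ} (hac : a < c) (hf : IntervalIntegrable f volume a c) :
    Tendsto (fun t => ∫ z in t..c, f z) (𝓝[<] c) (𝓝 0) := by
  have h1 := (continuousOn_integral_left hac.le hf c ⟨hac.le, le_rfl⟩).mono_left
    (nhdsWithin_le_of_mem (Icc_mem_nhdsLT hac))
  simpa using h1

/-- Lebesgue differentiation, with difference quotients from the right so that only intervals ending
before `c` are needed. -/
theorem ae_norm_le_of_norm_integral_le {E : Type*} [NormedAddCommGroup E] [NormedSpace ℝ E]
    [CompleteSpace E] {f : ℝ → E} {g : ℝ → ℝ} {a c : ℝ} (hac : a ≤ c)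
    (hf : IntervalIntegrable f volume a c) (hg : IntervalIntegrable g volume a c)
    (h : ∀ r s, a ≤ r → r < s → s < c → ‖∫ t in r..s, f t‖ ≤ ∫ t in r..s, g t) :
    ∀ᵐ t, t ∈ Ioc a c → ‖f t‖ ≤ g t := by
  have hb : ∀ᵐ t : ℝ, t ≠ c := by simp [ae_iff, measure_singleton]
  filter_upwards [hf.ae_hasDerivAt_integral, hg.ae_hasDerivAt_integral, hb] with t h1 h2 h3 ht
  have htm : t ∈ uIcc a c := by rw [uIcc_of_le hac]; exact Ioc_subset_Icc_self ht
  have htc : t < c := lt_of_le_of_ne ht.2 h3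
  have d1 := (hasDerivWithinAt_iff_tendsto_slope' (s := Ioi t) (by simp)).1
    (h1 htm a left_mem_uIcc).hasDerivWithinAt
  have d2 := (hasDerivWithinAt_iff_tendsto_slope' (s := Ioi t) (by simp)).1
    (h2 htm a left_mem_uIcc).hasDerivWithinAt
  refine le_of_tendsto_of_tendsto d1.norm d2 ?_
  filter_upwards [Ioo_mem_nhdsGT htc] with z hz
  have hzm : z ∈ uIcc a c := by rw [uIcc_of_le hac]; exact ⟨ht.1.le.trans hz.1.le, hz.2.le⟩
  rw [slope_def_module, slope_def_module, norm_smul, Real.norm_eq_abs,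
    abs_of_pos (inv_pos.2 (sub_pos.2 hz.1)), smul_eq_mul,
    intervalIntegral.integral_interval_sub_left (hf.mono_set (uIcc_subset_uIcc_left hzm))
      (hf.mono_set (uIcc_subset_uIcc_left htm)),
    intervalIntegral.integral_interval_sub_left (hg.mono_set (uIcc_subset_uIcc_left hzm))
      (hg.mono_set (uIcc_subset_uIcc_left htm))]
  exact mul_le_mul_of_nonneg_left (h t z ht.1.le hz.1 hz.2) (inv_pos.2 (sub_pos.2 hz.1)).le

end

/-! ### The momentum of a minimum action path -/

/-- The average momentum of the path `φ` between the times `t` and `L`, with respect to length. -/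
noncomputable def avgMomentum (b : Plane → Plane) (φ : ℝ → Plane) (L t : ℝ) : Plane :=
  (pathLength φ t L)⁻¹ • ∫ z in t..L, momentum b φ z

section

variable {b : Plane → Plane} {O y : Plane} {L : ℝ} {φ : ℝ → Plane}

theorem norm_momentum_le (b : Plane → Plane) (φ : ℝ → Plane) (t : ℝ) :
    ‖momentum b φ t‖ ≤ 2 * ‖b (φ t)‖ * ‖deriv φ t‖ := by
  refine (norm_sub_le _ _).trans (le_of_eq ?_)
  rw [norm_smul, norm_smul, norm_norm, norm_norm]; ring

variable (hb : Continuous b)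
include hb

theorem integral_momentum_eq_zero {r s : ℝ} (hrs : r ≤ s)
    (hφ : AbsolutelyContinuousOnInterval φ r s) (h0 : pathLength φ r s = 0) :
    ∫ t in r..s, momentum b φ t = 0 := by
  have hc : ContinuousOn φ (Icc r s) := by have := hφ.continuousOn; rwa [uIcc_of_le hrs] at this
  obtain ⟨M, hM⟩ := isCompact_Icc.exists_bound_of_continuousOn (hb.comp_continuousOn hc)
  simp only [Function.comp_apply] at hM
  have hi := (intervalIntegrable_deriv_of_absolutelyContinuous hφ).norm
  have h1 : ∫ t in r..s, ‖momentum b φ t‖ ≤ ∫ t in r..s, 2 * M * ‖deriv φ t‖ :=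
    intervalIntegral.integral_mono_on hrs (intervalIntegrable_momentum hb hφ).norm
      (hi.const_mul _) fun t ht => (norm_momentum_le b φ t).trans (by gcongr; exact hM t ht)
  have h2 := intervalIntegral.norm_integral_le_integral_norm (f := momentum b φ)
    (μ := volume) hrs
  rw [intervalIntegral.integral_const_mul] at h1
  change _ ≤ 2 * M * pathLength φ r s at h1
  rw [h0, mul_zero] at h1
  exact norm_le_zero_iff.1 (h2.trans h1)

variable (hmap : IsMAP b O y L φ)
include hmap

/-- The average over `[r, L]` is the length-weighted mean of those over `[r, s]` and `[s, L]`, so it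
differs from the latter by a fraction at most 1 of their difference. -/
theorem IsMAP.norm_avgMomentum_sub_le (hnc : ∀ t ∈ Ioo 0 L, 0 < pathLength φ t L)
    {K : ℝ≥0} {R β : ℝ} (hK : LipschitzOnWith K b (Metric.closedBall 0 R))
    (hR : ∀ t ∈ Icc 0 L, ‖φ t‖ ≤ R - 1) (hβ : 0 < β) {a : ℝ} (ha : 0 < a)
    (hβφ : ∀ t ∈ Icc a L, β ≤ ‖b (φ t)‖) {r s : ℝ} (har : a ≤ r) (hrs : r < s) (hsL : s < L) :
    ‖avgMomentum b φ L r - avgMomentum b φ L s‖ ≤ K / β * ∫ t in r..L, ‖momentum b φ t‖ := by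
  have hr : 0 < r := ha.trans_le har
  have hac := hmap.absCont_sub hr (hrs.trans hsL).le le_rfl
  have hac₁ := hmap.absCont_sub hr hrs.le hsL.le
  have hac₂ := hmap.absCont_sub (hr.trans hrs) hsL.le le_rfl
  have hadd := pathLength_add hac hrs.le hsL.le
  have hPadd : (∫ t in r..s, momentum b φ t) + ∫ t in s..L, momentum b φ t =
      ∫ t in r..L, momentum b φ t :=
    intervalIntegral.integral_add_adjacent_intervals (intervalIntegrable_momentum hb hac₁)
      (intervalIntegrable_momentum hb hac₂)
  have hA : 0 ≤ K / β * ∫ t in r..L, ‖momentum b φ t‖ :=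
    mul_nonneg (by positivity) (intervalIntegral.integral_nonneg (hrs.trans hsL).le
      fun _ _ => norm_nonneg _)
  have hls := hnc s ⟨hr.trans hrs, hsL⟩
  have hlr := hnc r ⟨hr, hrs.trans hsL⟩
  unfold avgMomentum
  rcases (pathLength_nonneg φ hrs.le).eq_or_lt with h0 | h0
  · have h1 := integral_momentum_eq_zero hb hrs.le hac₁ h0.symm
    rw [← hadd, ← hPadd, h1, ← h0, zero_add, zero_add, sub_self, norm_zero]
    exact hA
  · have hmain := norm_average_momentum_sub_le hb hmap hK hr hrs hsL le_rfl
      (fun t ht => hR t ⟨hr.le.trans ht.1, ht.2⟩) hβ (fun t ht => hβφ t ⟨har.trans ht.1, ht.2⟩)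
      h0 hls
    change ‖(pathLength φ r s)⁻¹ • _ - (pathLength φ s L)⁻¹ • _‖ ≤ _ at hmain
    set l₁ := pathLength φ r s
    set l₂ := pathLength φ s L
    set l := pathLength φ r L
    set P₁ := ∫ t in r..s, momentum b φ t
    set P₂ := ∫ t in s..L, momentum b φ t
    have heq : l⁻¹ • (∫ t in r..L, momentum b φ t) - l₂⁻¹ • P₂ =
        (l₁ / l) • (l₁⁻¹ • P₁ - l₂⁻¹ • P₂) := by
      rw [← hPadd, smul_add, smul_sub, smul_smul, smul_smul]
      have e1 : l₁ / l * l₁⁻¹ = l⁻¹ := by field_simp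
      have e2 : l₂⁻¹ = l⁻¹ + l₁ / l * l₂⁻¹ := by
        field_simp; linarith
      rw [e1]
      nth_rewrite 1 [e2]
      rw [add_smul]; abel
    rw [heq, norm_smul, Real.norm_eq_abs, abs_of_nonneg (by positivity)]
    refine (mul_le_of_le_one_left (norm_nonneg _) ?_).trans hmain
    rw [div_le_one hlr]; linarith

theorem IsMAP.norm_le_of_tendsto_avgMomentum (hnc : ∀ t ∈ Ioo 0 L, 0 < pathLength φ t L)
    {K : ℝ≥0} {R β : ℝ} (hK : LipschitzOnWith K b (Metric.closedBall 0 R))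
    (hR : ∀ t ∈ Icc 0 L, ‖φ t‖ ≤ R - 1) (hβ : 0 < β) {a : ℝ} (ha : 0 < a)
    (hβφ : ∀ t ∈ Icc a L, β ≤ ‖b (φ t)‖)
    (h0 : Tendsto (avgMomentum b φ L) (𝓝[<] L) (𝓝 0)) {r : ℝ} (har : a ≤ r) (hr : r < L) :
    ‖avgMomentum b φ L r‖ ≤ K / β * ∫ t in r..L, ‖momentum b φ t‖ := by
  have h1 := (tendsto_const_nhds (x := avgMomentum b φ L r)).sub h0
  rw [sub_zero] at h1
  refine le_of_tendsto h1.norm ?_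
  filter_upwards [Ioo_mem_nhdsLT hr] with s hs
  exact hmap.norm_avgMomentum_sub_le hb hnc hK hR hβ ha hβφ har hs.1 hs.2

/-- The averages are Cauchy because the integral of `‖P‖` over the remaining path tends to 0. -/
theorem IsMAP.exists_tendsto_avgMomentum (hnc : ∀ t ∈ Ioo 0 L, 0 < pathLength φ t L)
    {K : ℝ≥0} {R β : ℝ} (hK : LipschitzOnWith K b (Metric.closedBall 0 R))
    (hR : ∀ t ∈ Icc 0 L, ‖φ t‖ ≤ R - 1) (hβ : 0 < β) {a : ℝ} (ha : 0 < a) (haL : a < L)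
    (hβφ : ∀ t ∈ Icc a L, β ≤ ‖b (φ t)‖) :
    ∃ p, Tendsto (avgMomentum b φ L) (𝓝[<] L) (𝓝 p) := by
  refine cauchy_map_iff_exists_tendsto.1 ?_
  rw [Metric.cauchy_iff]
  refine ⟨inferInstance, fun ε hε => ?_⟩
  have hlim := (tendsto_integral_left haL (intervalIntegrable_momentum hb
    (hmap.absCont_sub ha haL.le le_rfl)).norm).const_mul (K / β)
  rw [mul_zero] at hlim
  obtain ⟨c, hcL, hc⟩ := (mem_nhdsLT_iff_exists_mem_Ico_Ioo_subset haL).1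
    (hlim.eventually (gt_mem_nhds hε))
  refine ⟨avgMomentum b φ L '' Ioo c L, image_mem_map (Ioo_mem_nhdsLT hcL.2), ?_⟩
  have key : ∀ r s, r ∈ Ioo c L → s ∈ Ioo c L → r < s →
      dist (avgMomentum b φ L r) (avgMomentum b φ L s) < ε := fun r s hr hs hrs => by
    rw [dist_eq_norm]
    exact (hmap.norm_avgMomentum_sub_le hb hnc hK hR hβ ha hβφ (hcL.1.trans hr.1.le) hrs
      hs.2).trans_lt (hc hr)
  rintro _ ⟨r, hr, rfl⟩ _ ⟨s, hs, rfl⟩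
  rcases lt_trichotomy r s with h | rfl | h
  · exact key r s hr hs h
  · rwa [dist_self]
  · rw [dist_comm]; exact key s r hs hr h

/-- A Gronwall argument run backwards from `L`. With limit 0, the approximate conservation law
bounds the momentum per unit length by the integral of its norm over the rest of the path. -/
theorem IsMAP.integral_norm_momentum_eq_zero (hnc : ∀ t ∈ Ioo 0 L, 0 < pathLength φ t L)
    {K : ℝ≥0} {R β : ℝ} (hK : LipschitzOnWith K b (Metric.closedBall 0 R))
    (hR : ∀ t ∈ Icc 0 L, ‖φ t‖ ≤ R - 1) (hβ : 0 < β) {a : ℝ} (ha : 0 < a) (haL : a < L)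
    (hβφ : ∀ t ∈ Icc a L, β ≤ ‖b (φ t)‖)
    (h0 : Tendsto (avgMomentum b φ L) (𝓝[<] L) (𝓝 0)) :
    ∫ t in a..L, ‖momentum b φ t‖ = 0 := by
  have hacr : ∀ {r}, a ≤ r → r ≤ L → AbsolutelyContinuousOnInterval φ r L := fun h1 h2 =>
    hmap.absCont_sub (ha.trans_le h1) h2 le_rfl
  have hP := intervalIntegrable_momentum hb (hacr le_rfl haL.le)
  have hv := (intervalIntegrable_deriv_of_absolutelyContinuous (hacr le_rfl haL.le)).norm
  set A : ℝ → ℝ := fun t => ∫ z in t..L, ‖momentum b φ z‖ with hA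
  have hA0 : ∀ {t}, t ≤ L → 0 ≤ A t := fun h =>
    intervalIntegral.integral_nonneg h fun _ _ => norm_nonneg _
  have hsub : ∀ {f : ℝ → ℝ}, IntervalIntegrable f volume a L → ∀ {r s}, a ≤ r → r ≤ s → s ≤ L →
      IntervalIntegrable f volume r s := fun hf r s h1 h2 h3 => hf.mono_set (by
    rw [uIcc_of_le h2, uIcc_of_le haL.le]; exact Icc_subset_Icc h1 h3)
  have hAadd : ∀ {r s}, a ≤ r → r ≤ s → s ≤ L →
      (∫ z in r..s, ‖momentum b φ z‖) + A s = A r := fun h1 h2 h3 =>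
    intervalIntegral.integral_add_adjacent_intervals (hsub hP.norm h1 h2 h3)
      (hsub hP.norm (h1.trans h2) h3 le_rfl)
  have hAanti : ∀ {r s}, a ≤ r → r ≤ s → s ≤ L → A s ≤ A r := fun {r s} h1 h2 h3 => by
    have := intervalIntegral.integral_nonneg (μ := volume) h2
      fun z (_ : z ∈ Icc r s) => norm_nonneg (momentum b φ z)
    linarith [hAadd h1 h2 h3]
  have hK0 : 0 ≤ (K : ℝ) / β := by positivity
  -- the momentum is controlled by its integral over the rest of the path
  have hae : ∀ r₀, a ≤ r₀ → r₀ < L →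
      ∀ᵐ t, t ∈ Ioc r₀ L → ‖momentum b φ t‖ ≤ 2 * (K / β) * A r₀ * ‖deriv φ t‖ := by
    intro r₀ har hrL
    refine ae_norm_le_of_norm_integral_le hrL.le (hP.mono_set (by
      rw [uIcc_of_le hrL.le, uIcc_of_le haL.le]; exact Icc_subset_Icc_left har))
      ((hsub hv har hrL.le le_rfl).const_mul _) fun r s hr hrs hsL => ?_
    have har' := har.trans hr
    have hrpos := ha.trans_le har'
    rw [intervalIntegral.integral_const_mul]
    change _ ≤ _ * pathLength φ r s
    have hb₁ := hmap.norm_le_of_tendsto_avgMomentum hb hnc hK hR hβ ha hβφ h0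
      (har'.trans hrs.le) hsL
    have hacrs := hmap.absCont_sub hrpos hrs.le hsL.le
    rcases (pathLength_nonneg φ hrs.le).eq_or_lt with hz | hz
    · rw [integral_momentum_eq_zero hb hrs.le hacrs hz.symm, ← hz]; simp
    · have hmain := norm_average_momentum_sub_le hb hmap hK hrpos hrs hsL le_rfl
        (fun t ht => hR t ⟨hrpos.le.trans ht.1, ht.2⟩) hβ
        (fun t ht => hβφ t ⟨har'.trans ht.1, ht.2⟩) hz (hnc s ⟨hrpos.trans hrs, hsL⟩)
      change ‖(pathLength φ r s)⁻¹ • _ - avgMomentum b φ L s‖ ≤ K / β * A r at hmain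
      change _ ≤ K / β * A s at hb₁
      have h1 : A s ≤ A r := hAanti har' hrs.le hsL.le
      have h2 : A r ≤ A r₀ := hAanti har hr (hrs.trans hsL).le
      have h3 : ‖(pathLength φ r s)⁻¹ • ∫ t in r..s, momentum b φ t‖ ≤ 2 * (K / β) * A r₀ := by
        calc _ ≤ ‖(pathLength φ r s)⁻¹ • (∫ t in r..s, momentum b φ t) - avgMomentum b φ L s‖ +
              ‖avgMomentum b φ L s‖ := by
                simpa using norm_add_le ((pathLength φ r s)⁻¹ • (∫ t in r..s, momentum b φ t) -
                  avgMomentum b φ L s) (avgMomentum b φ L s)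
          _ ≤ K / β * A r + K / β * A s := add_le_add hmain hb₁
          _ ≤ K / β * A r₀ + K / β * A r₀ := by gcongr; linarith
          _ = _ := by ring
      rw [norm_smul, norm_inv, Real.norm_eq_abs, abs_of_pos hz, inv_mul_le_iff₀ hz] at h3
      linarith
  have hcont : ContinuousOn A (Icc a L) := continuousOn_integral_left haL.le hP.norm
  -- `T` is the earliest time from which the momentum vanishes almost everywhere. If `a < T`, a
  -- short piece before `T` gives `A r ≤ A r / 2`, so `r` belongs to `S` too.
  set S : Set ℝ := Icc a L ∩ A ⁻¹' {0} with hS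
  have hSc : IsCompact S := by
    exact isCompact_Icc.of_isClosed_subset (hcont.preimage_isClosed_of_isClosed isClosed_Icc
      isClosed_singleton) inter_subset_left
  have hSne : S.Nonempty := ⟨L, ⟨haL.le, le_rfl⟩, by simp [hA]⟩
  set T := sInf S with hT
  have hTS : T ∈ S := hSc.sInf_mem hSne
  have hTa : T = a := by
    by_contra hne
    have haT : a < T := lt_of_le_of_ne hTS.1.1 (Ne.symm hne)
    have hlim := (tendsto_integral_left haT (hsub hv le_rfl haT.le hTS.1.2)).const_mul
      (2 * (K / β))
    rw [mul_zero] at hlim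
    obtain ⟨r, hr1, hr2⟩ := ((hlim.eventually (gt_mem_nhds (half_pos one_pos))).and
      (Ioo_mem_nhdsLT haT)).exists
    have hrL : r < L := hr2.2.trans_le hTS.1.2
    have h1 : ∫ z in r..T, ‖momentum b φ z‖ ≤
        ∫ z in r..T, 2 * (K / β) * A r * ‖deriv φ z‖ := by
      refine intervalIntegral.integral_mono_ae_restrict hr2.2.le (hsub hP.norm hr2.1.le hr2.2.le hTS.1.2)
        ((hsub hv hr2.1.le hr2.2.le hTS.1.2).const_mul _) ?_
      rw [EventuallyLE, ← restrict_Ioc_eq_restrict_Icc, ae_restrict_iff' measurableSet_Ioc]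
      filter_upwards [hae r hr2.1.le hrL] with t ht htm
      exact ht ⟨htm.1, htm.2.trans hTS.1.2⟩
    rw [intervalIntegral.integral_const_mul] at h1
    have hadd := hAadd hr2.1.le hr2.2.le hTS.1.2
    have hT0 : A T = 0 := hTS.2
    rw [hT0, add_zero] at hadd
    have hAr := hA0 hrL.le
    have h2 : A r ≤ 1 / 2 * A r := by
      calc A r ≤ 2 * (K / β) * A r * ∫ z in r..T, ‖deriv φ z‖ := by rw [← hadd]; rw [hadd]; linarith
        _ = (2 * (K / β) * ∫ z in r..T, ‖deriv φ z‖) * A r := by ring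
        _ ≤ 1 / 2 * A r := by gcongr
    have h3 : A r = 0 := by linarith
    have := csInf_le hSc.bddBelow (show r ∈ S from ⟨⟨hr2.1.le, hrL.le⟩, h3⟩)
    rw [← hT] at this
    exact absurd this (not_le.2 hr2.2)
  have := hTS.2
  rw [hTa] at this
  exact this

end

end Quasipotential

namespace Quasipotential

/-! ### The tangent of a minimum action path at its endpoint -/

section

variable {b : Plane → Plane} {O y : Plane} {L : ℝ} {φ : ℝ → Plane}

theorem exists_ball_lipschitzOnWith (hb : ContDiff ℝ ∞ b) (hφ : ContinuousOn φ (Icc 0 L)) :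
    ∃ (R : ℝ) (K : ℝ≥0), LipschitzOnWith K b (Metric.closedBall 0 R) ∧
      ∀ t ∈ Icc 0 L, ‖φ t‖ ≤ R - 1 := by
  obtain ⟨M, hM⟩ := isCompact_Icc.exists_bound_of_continuousOn hφ
  obtain ⟨K, hK⟩ := hb.contDiffOn.exists_lipschitzOnWith (s := Metric.closedBall 0 (M + 1))
    (by simp) (convex_closedBall _ _) (isCompact_closedBall _ _)
  exact ⟨M + 1, K, hK, fun t ht => by simpa using hM t ht⟩

variable (hb : Continuous b) (hmap : IsMAP b O y L φ)
include hmap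

theorem IsMAP.tendsto_pathLength : Tendsto (fun t => pathLength φ t L) (𝓝[<] L) (𝓝 0) := by
  have hL := hmap.pos
  exact tendsto_integral_left (half_lt_self hL) (intervalIntegrable_deriv_of_absolutelyContinuous
    (hmap.absCont_sub (half_pos hL) (half_le_self hL.le) le_rfl)).norm

theorem IsMAP.norm_sub_le_of_lipschitz {K : ℝ≥0} {R : ℝ}
    (hK : LipschitzOnWith K b (Metric.closedBall 0 R)) (hR : ∀ t ∈ Icc 0 L, ‖φ t‖ ≤ R - 1)
    {t z : ℝ} (ht : t ∈ Ioo 0 L) (hz : z ∈ Icc t L) :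
    ‖b (φ z) - b y‖ ≤ K * pathLength φ t L := by
  have hball : ∀ t ∈ Icc 0 L, φ t ∈ Metric.closedBall (0 : Plane) R := fun t ht => by
    rw [mem_closedBall_zero_iff]; linarith [hR t ht]
  have h1 := hK.norm_sub_le (hball z ⟨ht.1.le.trans hz.1, hz.2⟩)
    (hball L ⟨hmap.pos.le, le_rfl⟩)
  have h2 := norm_sub_le_pathLength_of_mem (hmap.absCont_sub ht.1 ht.2.le le_rfl) hz
  rw [hmap.finish] at h1 h2
  exact h1.trans (by gcongr)

include hb

/-- The calibration identity on `[t, L]` with the drift frozen at `y`. -/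
theorem IsMAP.toReal_quasipotential_ge {K : ℝ≥0} {R : ℝ}
    (hK : LipschitzOnWith K b (Metric.closedBall 0 R)) (hR : ∀ t ∈ Icc 0 L, ‖φ t‖ ≤ R - 1)
    {t : ℝ} (ht : t ∈ Ioo 0 L) :
    (quasipotential b O (φ t)).toReal + ‖b y‖ * pathLength φ t L - inner ℝ (y - φ t) (b y) -
      2 * K * pathLength φ t L ^ 2 ≤ (quasipotential b O y).toReal := by
  have hac := hmap.absCont_sub ht.1 ht.2.le le_rfl
  have hd := intervalIntegrable_deriv_of_absolutelyContinuous hac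
  have hc : ContinuousOn φ (Icc t L) := by
    have := hac.continuousOn; rwa [uIcc_of_le ht.2.le] at this
  have hcal := hmap.toReal_quasipotential_eq hb ht.1 ht.2.le le_rfl
  rw [hmap.finish] at hcal
  have i1 : IntervalIntegrable (fun z => ‖deriv φ z‖ * ‖b y‖) volume t L := hd.norm.mul_const _
  have i2 : IntervalIntegrable (fun z => inner ℝ (deriv φ z) (b y)) volume t L :=
    ⟨hd.1.inner_const _, hd.2.inner_const _⟩
  have i3 : IntervalIntegrable (fun z => 2 * (K * pathLength φ t L) * ‖deriv φ z‖) volume t L :=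
    hd.norm.const_mul _
  have hmono := intervalIntegral.integral_mono_on ht.2.le ((i1.sub i2).sub i3)
    (intervalIntegrable_lagrangian hb ht.2.le hc hd) fun z hz => by
      have h1 := neg_le_of_abs_le (abs_lagrangian_sub_le b (φ z) y (deriv φ z))
      have h2 : 2 * ‖b (φ z) - b y‖ * ‖deriv φ z‖ ≤
          2 * (K * pathLength φ t L) * ‖deriv φ z‖ := by
        gcongr; exact hmap.norm_sub_le_of_lipschitz hK hR ht hz
      change ‖deriv φ z‖ * ‖b y‖ - inner ℝ (deriv φ z) (b y) - _ ≤ _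
      have h3 : lagrangian b y (deriv φ z) =
        ‖deriv φ z‖ * ‖b y‖ - inner ℝ (deriv φ z) (b y) := rfl
      linarith
  rw [intervalIntegral.integral_sub (i1.sub i2) i3, intervalIntegral.integral_sub i1 i2,
    intervalIntegral.integral_mul_const, intervalIntegral.integral_const_mul] at hmono
  have hin : ∫ z in t..L, inner ℝ (deriv φ z) (b y) = inner ℝ (y - φ t) (b y) := by
    have h1 := (innerSL ℝ (b y)).intervalIntegral_comp_comm hd
    simp only [innerSL_apply_apply] at h1
    simp only [real_inner_comm (b y)]
    rw [h1, integral_deriv_of_absolutelyContinuous hac, hmap.finish]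
  rw [hin] at hmono
  change pathLength φ t L * _ - _ - 2 * (K * pathLength φ t L) * pathLength φ t L ≤ _ at hmono
  nlinarith

/-- The rest of the path costs no more than its chord. With the drift frozen at `y`, the terms in `b
y · (y - φ t)` cancel, and only length and chord are compared. -/
theorem IsMAP.pathLength_le_norm_sub {K : ℝ≥0} {R : ℝ}
    (hK : LipschitzOnWith K b (Metric.closedBall 0 R)) (hR : ∀ t ∈ Icc 0 L, ‖φ t‖ ≤ R - 1)
    {t : ℝ} (ht : t ∈ Ioo 0 L) :
    ‖b y‖ * pathLength φ t L ≤ ‖b y‖ * ‖φ t - y‖ + 4 * K * pathLength φ t L ^ 2 := by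
  have hl := norm_sub_le_pathLength_of_mem (hmap.absCont_sub ht.1 ht.2.le le_rfl)
    (left_mem_Icc.2 ht.2.le)
  rw [hmap.finish] at hl
  have hge := hmap.toReal_quasipotential_ge hb hK hR ht
  have hyR : y ∈ Metric.closedBall (0 : Plane) R := by
    rw [mem_closedBall_zero_iff, ← hmap.finish]; linarith [hR L ⟨hmap.pos.le, le_rfl⟩]
  have htR : φ t ∈ Metric.closedBall (0 : Plane) R := by
    rw [mem_closedBall_zero_iff]; linarith [hR t ⟨ht.1.le, ht.2.le⟩]
  have hle := toReal_quasipotential_le_line hb (O := O) (x := φ t) (x' := y) (c := y)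
    (η := K * pathLength φ t L) fun z hz => by
      refine (hK.norm_sub_le ((convex_closedBall _ _).segment_subset htR hyR hz) hyR).trans ?_
      gcongr
      refine le_trans ?_ hl
      have := segment_subset_closedBall_right (φ t) y hz
      rwa [mem_closedBall_iff_norm] at this
  have h3 : lagrangian b y (y - φ t) = ‖y - φ t‖ * ‖b y‖ - inner ℝ (y - φ t) (b y) := rfl
  rw [h3, norm_sub_rev y] at hle
  have h4 : 2 * (K * pathLength φ t L) * ‖φ t - y‖ ≤ 2 * K * pathLength φ t L ^ 2 := by
    calc _ ≤ 2 * (K * pathLength φ t L) * pathLength φ t L := by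
          gcongr; have := pathLength_nonneg φ ht.2.le; positivity
      _ = _ := by ring
  linarith

/-- With the drift frozen at `y`, the momentum integrates exactly. This converts convergence of the
averages into convergence of `(φ t - y)/ℓ(t)`. -/
theorem IsMAP.norm_avgMomentum_add_le {K : ℝ≥0} {R : ℝ}
    (hK : LipschitzOnWith K b (Metric.closedBall 0 R)) (hR : ∀ t ∈ Icc 0 L, ‖φ t‖ ≤ R - 1)
    {t : ℝ} (ht : t ∈ Ioo 0 L) (hl : 0 < pathLength φ t L) :
    ‖avgMomentum b φ L t + (‖b y‖ • ((pathLength φ t L)⁻¹ • (φ t - y)) + b y)‖ ≤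
      2 * K * pathLength φ t L := by
  have hac := hmap.absCont_sub ht.1 ht.2.le le_rfl
  have hd := intervalIntegrable_deriv_of_absolutelyContinuous hac
  have hP := intervalIntegrable_momentum hb hac
  have i1 : IntervalIntegrable (fun z => ‖b y‖ • deriv φ z) volume t L :=
    hd.continuousOn_smul continuousOn_const
  have i2 : IntervalIntegrable (fun z => ‖deriv φ z‖ • b y) volume t L :=
    hd.norm.smul_continuousOn continuousOn_const
  have hE : ‖∫ z in t..L, (momentum b φ z - (‖b y‖ • deriv φ z - ‖deriv φ z‖ • b y))‖ ≤
      ∫ z in t..L, 2 * (K * pathLength φ t L) * ‖deriv φ z‖ := by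
    refine intervalIntegral.norm_integral_le_of_norm_le ht.2.le
      (Eventually.of_forall fun z hz => ?_) (hd.norm.const_mul _)
    have h1 := hmap.norm_sub_le_of_lipschitz hK hR ht (Ioc_subset_Icc_self hz)
    have h2 : momentum b φ z - (‖b y‖ • deriv φ z - ‖deriv φ z‖ • b y) =
        (‖b (φ z)‖ - ‖b y‖) • deriv φ z - ‖deriv φ z‖ • (b (φ z) - b y) := by
      unfold momentum; module
    rw [h2]
    refine (norm_sub_le _ _).trans ?_
    rw [norm_smul, norm_smul, norm_norm, Real.norm_eq_abs]
    have h3 : |‖b (φ z)‖ - ‖b y‖| * ‖deriv φ z‖ ≤ K * pathLength φ t L * ‖deriv φ z‖ := by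
      gcongr; exact (abs_norm_sub_norm_le _ _).trans h1
    have h4 : ‖deriv φ z‖ * ‖b (φ z) - b y‖ ≤ ‖deriv φ z‖ * (K * pathLength φ t L) := by gcongr
    linarith
  rw [intervalIntegral.integral_sub hP (i1.sub i2), intervalIntegral.integral_sub i1 i2,
    intervalIntegral.integral_smul, intervalIntegral.integral_smul_const,
    integral_deriv_of_absolutelyContinuous hac, hmap.finish,
    intervalIntegral.integral_const_mul] at hE
  change ‖_ - (_ - pathLength φ t L • b y)‖ ≤ _ * pathLength φ t L at hE
  set l := pathLength φ t L
  have heq : avgMomentum b φ L t + (‖b y‖ • (l⁻¹ • (φ t - y)) + b y) =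
      l⁻¹ • ((∫ z in t..L, momentum b φ z) - (‖b y‖ • (y - φ t) - l • b y)) := by
    have h1 : b y = l⁻¹ • l • b y := by rw [smul_smul, inv_mul_cancel₀ hl.ne', one_smul]
    unfold avgMomentum
    nth_rewrite 2 [h1]
    module
  rw [heq, norm_smul, norm_inv, Real.norm_eq_abs, abs_of_pos hl, inv_mul_le_iff₀ hl]
  linarith

theorem IsMAP.exists_lower_bound (hy : b y ≠ 0) :
    ∃ a ∈ Ioo 0 L, ∀ t ∈ Icc a L, ‖b y‖ / 2 ≤ ‖b (φ t)‖ := by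
  have hL := hmap.pos
  have h1 : ContinuousWithinAt (fun t => ‖b (φ t)‖) (Icc 0 L) L :=
    ((hb.comp_continuousOn hmap.continuousOn).norm) L ⟨hL.le, le_rfl⟩
  have h2 : Tendsto (fun t => ‖b (φ t)‖) (𝓝[≤] L) (𝓝 ‖b y‖) := by
    have := h1.tendsto.mono_left (nhdsWithin_le_of_mem (Icc_mem_nhdsLE hL))
    rwa [hmap.finish] at this
  obtain ⟨c, hc, h⟩ := (mem_nhdsLE_iff_exists_mem_Ico_Ioc_subset hL).1
    (h2.eventually (lt_mem_nhds (half_lt_self (norm_pos_iff.2 hy))))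
  refine ⟨(c + L) / 2, ⟨by linarith [hc.1, hc.2], by linarith [hc.2]⟩, fun t ht => ?_⟩
  exact le_of_lt (h ⟨by linarith [ht.1, hc.2], ht.2⟩)

/-- The limit exists by convergence of the momentum averages. It has norm at most 1 since chords are
no longer than arcs, and at least 1 by `IsMAP.pathLength_le_norm_sub`. -/
theorem IsMAP.exists_tangent {K : ℝ≥0} {R : ℝ}
    (hK : LipschitzOnWith K b (Metric.closedBall 0 R)) (hR : ∀ t ∈ Icc 0 L, ‖φ t‖ ≤ R - 1)
    (hnc : ∀ t ∈ Ioo 0 L, 0 < pathLength φ t L) (hy : b y ≠ 0) :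
    ∃ w : Plane, ‖w‖ = 1 ∧
      Tendsto (fun t => (pathLength φ t L)⁻¹ • (φ t - y)) (𝓝[<] L) (𝓝 w) ∧
      Tendsto (avgMomentum b φ L) (𝓝[<] L) (𝓝 (-(‖b y‖ • w + b y))) := by
  have hyp : 0 < ‖b y‖ := norm_pos_iff.2 hy
  obtain ⟨a, ha, hβ⟩ := hmap.exists_lower_bound hb hy
  obtain ⟨p, hp⟩ := hmap.exists_tendsto_avgMomentum hb hnc hK hR (half_pos hyp) ha.1 ha.2 hβ
  have hl := hmap.tendsto_pathLength
  have hnear : ∀ᶠ t in 𝓝[<] L, t ∈ Ioo 0 L := Ioo_mem_nhdsLT hmap.pos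
  have h1 : Tendsto (fun t => avgMomentum b φ L t +
      (‖b y‖ • ((pathLength φ t L)⁻¹ • (φ t - y)) + b y)) (𝓝[<] L) (𝓝 0) := by
    have h2 := hl.const_mul (2 * (K : ℝ))
    rw [mul_zero] at h2
    refine squeeze_zero_norm' ?_ h2
    filter_upwards [hnear] with t ht
    exact hmap.norm_avgMomentum_add_le hb hK hR ht (hnc t ht)
  have h2 : Tendsto (fun t => (pathLength φ t L)⁻¹ • (φ t - y)) (𝓝[<] L)
      (𝓝 (‖b y‖⁻¹ • (0 - p - b y))) := by
    refine (((h1.sub hp).sub_const (b y)).const_smul ‖b y‖⁻¹).congr fun t => ?_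
    rw [add_sub_cancel_left, add_sub_cancel_right, smul_smul, inv_mul_cancel₀ hyp.ne', one_smul]
  refine ⟨_, ?_, h2, ?_⟩
  · refine le_antisymm (le_of_tendsto h2.norm ?_) ?_
    · filter_upwards [hnear] with t ht
      have h3 := norm_sub_le_pathLength_of_mem (hmap.absCont_sub ht.1 ht.2.le le_rfl)
        (left_mem_Icc.2 ht.2.le)
      rw [hmap.finish] at h3
      rw [norm_smul, norm_inv, Real.norm_eq_abs, abs_of_pos (hnc t ht), inv_mul_le_iff₀ (hnc t ht)]
      linarith
    · have h3 := (hl.const_mul (4 * (K : ℝ) / ‖b y‖)).const_sub 1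
      rw [mul_zero, sub_zero] at h3
      refine le_of_tendsto_of_tendsto h3 h2.norm ?_
      filter_upwards [hnear] with t ht
      have h4 := hmap.pathLength_le_norm_sub hb hK hR ht
      have h5 := hnc t ht
      rw [norm_smul, norm_inv, Real.norm_eq_abs, abs_of_pos h5, le_inv_mul_iff₀ h5]
      have h6 : pathLength φ t L * (1 - 4 * K / ‖b y‖ * pathLength φ t L) =
        (‖b y‖ * pathLength φ t L - 4 * K * pathLength φ t L ^ 2) / ‖b y‖ := by
        field_simp
      rw [h6, div_le_iff₀ hyp]
      linarith
  · convert hp using 2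
    rw [smul_smul, mul_inv_cancel₀ hyp.ne', one_smul]; abel

end

end Quasipotential

namespace Quasipotential

/-! ### Paths that follow the flow -/

section

variable {b : Plane → Plane} {O y : Plane} {L : ℝ} {φ : ℝ → Plane}

/-- Gronwall uniqueness with an integrable rate, by continuous induction on the zero set of `D`. -/
theorem eq_zero_of_ae_deriv_norm_le {D : ℝ → Plane} {σ : ℝ → ℝ} {t q C : ℝ} (htq : t ≤ q)
    (hD : AbsolutelyContinuousOnInterval D t q) (hσ : IntervalIntegrable σ volume t q)
    (hσ0 : ∀ r, 0 ≤ σ r) (hC : 0 ≤ C) (h0 : D t = 0)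
    (h : ∀ᵐ r, r ∈ Ioc t q → ‖deriv D r‖ ≤ C * σ r * ‖D r‖) : ∀ r ∈ Icc t q, D r = 0 := by
  have hcont : ContinuousOn D (Icc t q) := by
    have := hD.continuousOn; rwa [uIcc_of_le htq] at this
  have hclosed : IsClosed ({r | D r = 0} ∩ Icc t q) := by
    rw [inter_comm]
    exact hcont.preimage_isClosed_of_isClosed isClosed_Icc isClosed_singleton
  refine hclosed.Icc_subset_of_forall_exists_gt h0 fun x hx z hz => ?_
  obtain ⟨hx0, hxt, hxq⟩ := hx
  have hxq' : x ∈ uIcc t q := by rw [uIcc_of_le htq]; exact ⟨hxt, hxq.le⟩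
  have hσx : IntervalIntegrable σ volume x q := hσ.mono_set (uIcc_subset_uIcc_right hxq')
  have hlim : Tendsto (fun r => C * ∫ u in x..r, σ u) (𝓝[>] x) (𝓝 0) := by
    have h1 := (absolutelyContinuousOnInterval_primitive hσx).continuousOn
    rw [uIcc_of_le hxq.le] at h1
    have h2 := ((h1 x ⟨le_rfl, hxq.le⟩).mono_left
      (nhdsWithin_le_of_mem (Icc_mem_nhdsGT hxq))).const_mul C
    simpa using h2
  -- On `[x, u]` the rate integrates to less than one half, so the maximum of `‖D‖` there is at most
  -- half of itself.
  obtain ⟨u, hu1, hu2⟩ := ((hlim.eventually (gt_mem_nhds (half_pos one_pos))).and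
    (Ioo_mem_nhdsGT (lt_min hxq hz))).exists
  have huq : u < q := hu2.2.trans_le (min_le_left _ _)
  have huz : u < z := hu2.2.trans_le (min_le_right _ _)
  refine ⟨u, ?_, hu2.1, huz.le⟩
  obtain ⟨m, hm, hmax⟩ := isCompact_Icc.exists_isMaxOn (nonempty_Icc.2 hu2.1.le)
    (hcont.mono (Icc_subset_Icc hxt huq.le)).norm
  have hsubi : ∀ {f : ℝ → ℝ}, IntervalIntegrable f volume t q →
      IntervalIntegrable f volume x m := fun hf => hf.mono_set (by
    rw [uIcc_of_le hm.1, uIcc_of_le htq]; exact Icc_subset_Icc hxt (hm.2.trans huq.le))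
  have hDm : D m = ∫ r in x..m, deriv D r := by
    rw [integral_deriv_of_absolutelyContinuous (hD.mono (by
      rw [uIcc_of_le hm.1, uIcc_of_le htq]; exact Icc_subset_Icc hxt (hm.2.trans huq.le)))]
    rw [mem_ofPred_eq] at hx0
    rw [hx0, sub_zero]
  have hle : ‖D m‖ ≤ ∫ r in x..m, C * σ r * ‖D m‖ := by
    nth_rewrite 1 [hDm]
    refine intervalIntegral.norm_integral_le_of_norm_le hm.1 ?_
      (((hsubi hσ).const_mul C).mul_const _)
    filter_upwards [h] with r hr hrm
    refine (hr ⟨hxt.trans_lt hrm.1, hrm.2.trans (hm.2.trans huq.le)⟩).trans ?_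
    have := hσ0 r
    gcongr
    exact hmax ⟨hrm.1.le, hrm.2.trans hm.2⟩
  rw [intervalIntegral.integral_mul_const, intervalIntegral.integral_const_mul] at hle
  have hmono : ∫ r in x..m, σ r ≤ ∫ r in x..u, σ r :=
    intervalIntegral.integral_mono_interval le_rfl hm.1 hm.2 (Eventually.of_forall hσ0)
      (hσ.mono_set (by
        rw [uIcc_of_le hu2.1.le, uIcc_of_le htq]; exact Icc_subset_Icc hxt huq.le))
  have h2 : ‖D m‖ ≤ 1 / 2 * ‖D m‖ := hle.trans (by
    gcongr
    exact (mul_le_mul_of_nonneg_left hmono hC).trans hu1.le)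
  have h3 : ‖D m‖ = 0 := le_antisymm (by linarith) (norm_nonneg _)
  have h4 : ‖D u‖ ≤ ‖D m‖ := hmax ⟨hu2.1.le, le_rfl⟩
  exact norm_le_zero_iff.1 (h4.trans h3.le)

/-- The new time is the integral of `σ`. In this time `γ` satisfies the same equation as `ψ`, and
Gronwall applies to the difference. -/
theorem eq_integralCurve_of_deriv_eq_smul (hb : ContDiff ℝ ∞ b) {ψ γ : ℝ → Plane} {σ : ℝ → ℝ}
    {t q : ℝ} (htq : t ≤ q) (hψ : AbsolutelyContinuousOnInterval ψ t q)
    (hσ : IntervalIntegrable σ volume t q) (hσ0 : ∀ r, 0 ≤ σ r)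
    (hd : ∀ᵐ r, r ∈ Ioc t q → deriv ψ r = σ r • b (ψ r))
    (hγ : IsIntegralCurveOn γ (fun _ => b) (Ici 0)) (h0 : γ 0 = ψ t) :
    ψ q = γ (∫ r in t..q, σ r) := by
  set τ : ℝ → ℝ := fun r => ∫ u in t..r, σ u with hτ
  have hτac : AbsolutelyContinuousOnInterval τ t q := absolutelyContinuousOnInterval_primitive hσ
  have hτ0 : ∀ r ∈ Icc t q, 0 ≤ τ r := fun r hr =>
    intervalIntegral.integral_nonneg hr.1 fun _ _ => hσ0 _
  have hτq : ∀ r ∈ Icc t q, τ r ≤ τ q := fun r hr =>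
    intervalIntegral.integral_mono_interval le_rfl hr.1 hr.2 (Eventually.of_forall hσ0) hσ
  have hγc : ContinuousOn γ (Icc 0 (τ q)) := hγ.continuousOn.mono Icc_subset_Ici_self
  obtain ⟨M, hM⟩ := isCompact_Icc.exists_bound_of_continuousOn (hb.continuous.comp_continuousOn hγc)
  obtain ⟨R₁, hR₁⟩ := isCompact_Icc.exists_bound_of_continuousOn hγc
  have hψc : ContinuousOn ψ (Icc t q) := by
    have := hψ.continuousOn; rwa [uIcc_of_le htq] at this
  obtain ⟨R₂, hR₂⟩ := isCompact_Icc.exists_bound_of_continuousOn hψc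
  obtain ⟨K, hK⟩ := hb.contDiffOn.exists_lipschitzOnWith (s := Metric.closedBall 0 (max R₁ R₂))
    (by simp) (convex_closedBall _ _) (isCompact_closedBall _ _)
  have hlip : ∀ x ∈ Icc 0 (τ q), ∀ z ∈ Icc 0 (τ q), ‖γ z - γ x‖ ≤ M * ‖z - x‖ := fun x hx z hz =>
    (convex_Icc 0 (τ q)).norm_image_sub_le_of_norm_hasDerivWithin_le
      (fun u hu => (hγ u hu.1).mono Icc_subset_Ici_self) (fun u hu => hM u hu) hx hz
  have hcomp : AbsolutelyContinuousOnInterval (fun r => γ (τ r)) t q := by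
    refine absolutelyContinuousOnInterval_of_dist_le (hτac.const_mul M) fun x hx z hz => ?_
    rw [uIcc_of_le htq] at hx hz
    have hM0 : 0 ≤ M := (norm_nonneg _).trans (hM (τ x) ⟨hτ0 x hx, hτq x hx⟩)
    rw [dist_eq_norm, dist_eq_norm, ← mul_sub, norm_mul, Real.norm_eq_abs M, abs_of_nonneg hM0]
    exact hlip _ ⟨hτ0 z hz, hτq z hz⟩ _ ⟨hτ0 x hx, hτq x hx⟩
  have hzero := eq_zero_of_ae_deriv_norm_le (D := fun r => ψ r - γ (τ r)) (C := K) htq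
    (hψ.fun_sub hcomp) hσ hσ0 K.2 (by simp [hτ, h0]) (by
      have hb : ∀ᵐ r : ℝ, r ≠ q := by simp [ae_iff, measure_singleton]
      filter_upwards [hd, ae_differentiableAt_of_absolutelyContinuous hψ,
        hσ.ae_hasDerivAt_integral, hb] with r h1 h2 h3 h4 hr
      have hrm : r ∈ Icc t q := Ioc_subset_Icc_self hr
      have hru : r ∈ uIcc t q := by rwa [uIcc_of_le htq]
      have d1 : HasDerivWithinAt (fun r => γ (τ r)) (σ r • b (γ (τ r))) (Icc t q) r :=
        (hγ (τ r) (hτ0 r hrm)).scomp r (h3 hru t left_mem_uIcc).hasDerivWithinAt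
          fun x hx => hτ0 x hx
      have d2 := d1.hasDerivAt (Icc_mem_nhds hr.1 (lt_of_le_of_ne hr.2 h4))
      have d3 := (h2 hru).hasDerivAt.fun_sub d2
      rw [d3.deriv, h1 hr, ← smul_sub, norm_smul, Real.norm_eq_abs, abs_of_nonneg (hσ0 r)]
      have hle := hK.norm_sub_le (x := ψ r) (y := γ (τ r))
        (mem_closedBall_zero_iff.2 ((hR₂ r hrm).trans (le_max_right _ _)))
        (mem_closedBall_zero_iff.2 ((hR₁ _ ⟨hτ0 r hrm, hτq r hrm⟩).trans (le_max_left _ _)))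
      calc σ r * ‖b (ψ r) - b (γ (τ r))‖ ≤ σ r * (K * ‖ψ r - γ (τ r)‖) :=
            mul_le_mul_of_nonneg_left hle (hσ0 r)
        _ = _ := by ring)
  exact sub_eq_zero.1 (hzero q ⟨htq, le_rfl⟩)

theorem eq_of_mem_basin_of_eq_zero (hb : ContDiff ℝ ∞ b) {x : Plane} (hx : x ∈ basin b O)
    (h0 : b x = 0) : x = O := by
  obtain ⟨γ, hγ, hγ0, hlim⟩ := hx
  have hconst : ∀ q ≥ (0 : ℝ), x = γ q := fun q hq => by
    have h := eq_integralCurve_of_deriv_eq_smul hb (ψ := fun _ => x) (σ := fun _ => 1) hq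
      ((LipschitzWith.const x).lipschitzOnWith (s := uIcc 0 q)).absolutelyContinuousOnInterval
      intervalIntegrable_const (fun _ => zero_le_one)
      (Eventually.of_forall fun r _ => by simp [h0]) hγ hγ0
    simpa using h
  refine tendsto_nhds_unique (tendsto_const_nhds (x := x) (f := atTop (α := ℝ))) (hlim.congr' ?_)
  filter_upwards [eventually_ge_atTop 0] with q hq using (hconst q hq).symm

theorem IsStableAttractor.ne_of_ne_zero (hO : IsStableAttractor b O) (hy : b y ≠ 0) : y ≠ O := by
  rintro rfl; exact hy hO.equilibrium

/-- Otherwise the path would follow the flow up to `y`, starting from a point so close to `O` that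
stability forbids reaching `y`. -/
theorem IsMAP.not_tendsto_avgMomentum_zero (hmap : IsMAP b O y L φ) (hb : ContDiff ℝ ∞ b)
    (hO : IsStableAttractor b O) (hy : b y ≠ 0) (hbasin : ∀ t ∈ Icc 0 L, φ t ∈ basin b O)
    (hnc : ∀ t ∈ Ioo 0 L, 0 < pathLength φ t L) :
    ¬ Tendsto (avgMomentum b φ L) (𝓝[<] L) (𝓝 0) := by
  intro hlim
  have hyO : y ≠ O := hO.ne_of_ne_zero hy
  obtain ⟨R, K, hK, hR⟩ := exists_ball_lipschitzOnWith hb hmap.continuousOn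
  -- `T` is the last visit to `O`. After it the drift does not vanish on the path, since `O` is the
  -- only equilibrium in its basin.
  set S : Set ℝ := Icc 0 L ∩ φ ⁻¹' {O} with hS
  have hSc : IsCompact S := isCompact_Icc.of_isClosed_subset
    (hmap.continuousOn.preimage_isClosed_of_isClosed isClosed_Icc isClosed_singleton)
    inter_subset_left
  have hSne : S.Nonempty := ⟨0, ⟨le_rfl, hmap.pos.le⟩, hmap.start⟩
  have hTS := hSc.sSup_mem hSne
  set T := sSup S with hT
  have hTO : φ T = O := hTS.2
  have hTL : T < L := lt_of_le_of_ne hTS.1.2 fun h => hyO (by rw [← hmap.finish, ← h, hTO])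
  have hbne : ∀ t ∈ Ioc T L, b (φ t) ≠ 0 := fun t ht h0 => by
    have hm : t ∈ Icc 0 L := ⟨hTS.1.1.trans ht.1.le, ht.2⟩
    have h1 := eq_of_mem_basin_of_eq_zero hb (hbasin t hm) h0
    exact absurd (le_csSup hSc.bddAbove (show t ∈ S from ⟨hm, h1⟩)) (not_le.2 ht.1)
  obtain ⟨δ, hδ, hstab⟩ := hO.stable (dist y O) (dist_pos.2 hyO)
  have hφT : Tendsto φ (𝓝[>] T) (𝓝 O) := by
    have := (hmap.continuousOn T hTS.1).mono_left
      (nhdsWithin_le_of_mem (mem_of_superset (Icc_mem_nhdsGT hTL) (Icc_subset_Icc_left hTS.1.1)))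
    rwa [hTO] at this
  obtain ⟨a, ha1, ha2⟩ := ((hφT.eventually (Metric.ball_mem_nhds O hδ)).and
    (Ioo_mem_nhdsGT hTL)).exists
  have ha0 : 0 < a := hTS.1.1.trans_lt ha2.1
  have hac := hmap.absCont_sub ha0 ha2.2.le le_rfl
  have hc : ContinuousOn φ (Icc a L) := hmap.continuousOn.mono (Icc_subset_Icc_left ha0.le)
  have hbc : ContinuousOn (fun t => ‖b (φ t)‖) (Icc a L) :=
    (hb.continuous.comp_continuousOn hc).norm
  obtain ⟨m, hm, hmin⟩ := isCompact_Icc.exists_isMinOn (nonempty_Icc.2 ha2.2.le) hbc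
  have hβ : 0 < ‖b (φ m)‖ := norm_pos_iff.2 (hbne m ⟨ha2.1.trans_le hm.1, hm.2⟩)
  have hint := hmap.integral_norm_momentum_eq_zero hb.continuous hnc hK hR hβ ha0 ha2.2
    (fun t ht => hmin ht) hlim
  have hP := intervalIntegrable_momentum hb.continuous hac
  rw [intervalIntegral.integral_eq_zero_iff_of_le_of_nonneg_ae ha2.2.le
    (Eventually.of_forall fun _ => norm_nonneg _) hP.norm, EventuallyEq,
    ae_restrict_iff' measurableSet_Ioc] at hint
  obtain ⟨γ, hγ, hγ0, -⟩ := hbasin a ⟨ha0.le, ha2.2.le⟩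
  have hi := (intervalIntegrable_deriv_of_absolutelyContinuous hac).norm
  have hσ : IntervalIntegrable (fun t => ‖deriv φ t‖ * ‖b (φ t)‖⁻¹) volume a L := by
    refine hi.mul_continuousOn ?_
    rw [uIcc_of_le ha2.2.le]
    exact hbc.inv₀ fun t ht => (norm_pos_iff.2 (hbne t ⟨ha2.1.trans_le ht.1, ht.2⟩)).ne'
  have hend := eq_integralCurve_of_deriv_eq_smul hb ha2.2.le hac hσ (fun r => by positivity) (by
    filter_upwards [hint] with t ht htm
    have h1 : momentum b φ t = 0 := norm_eq_zero.1 (ht htm)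
    have h2 : ‖b (φ t)‖ ≠ 0 := (norm_pos_iff.2 (hbne t ⟨ha2.1.trans htm.1, htm.2⟩)).ne'
    have h3 : ‖b (φ t)‖ • deriv φ t = ‖deriv φ t‖ • b (φ t) := sub_eq_zero.1 h1
    rw [mul_comm, mul_smul, ← h3, smul_smul, inv_mul_cancel₀ h2, one_smul]) hγ hγ0
  have hlt := hstab γ hγ (by rw [hγ0]; exact ha1) (∫ t in a..L, ‖deriv φ t‖ * ‖b (φ t)‖⁻¹)
    (intervalIntegral.integral_nonneg ha2.2.le fun _ _ => by positivity)
  rw [← hend, hmap.finish] at hlt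
  exact lt_irrefl _ hlt

/-- Shows that a piece of path without cost carries no momentum. -/
theorem norm_momentum_sq (b : Plane → Plane) (φ : ℝ → Plane) (t : ℝ) :
    ‖momentum b φ t‖ ^ 2 =
      2 * ‖deriv φ t‖ * ‖b (φ t)‖ * lagrangian b (φ t) (deriv φ t) := by
  unfold momentum lagrangian
  rw [norm_sub_sq_real, norm_smul, norm_smul, norm_norm, norm_norm, inner_smul_left,
    inner_smul_right]
  simp only [conj_trivial]; ring

/-- A return to `y` would be a loop of zero action, hence without momentum, which contradicts the
nonzero limit of the averages. -/
theorem IsMAP.ne_finish (hmap : IsMAP b O y L φ) (hb : ContDiff ℝ ∞ b)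
    (hO : IsStableAttractor b O) (hy : b y ≠ 0) (hbasin : ∀ t ∈ Icc 0 L, φ t ∈ basin b O)
    (hnc : ∀ t ∈ Ioo 0 L, 0 < pathLength φ t L) {t : ℝ} (ht : t ∈ Ico 0 L) : φ t ≠ y := by
  intro heq
  rcases ht.1.eq_or_lt with h0 | h0
  · rw [← h0, hmap.start] at heq
    exact hO.ne_of_ne_zero hy heq.symm
  have hcal := hmap.toReal_quasipotential_eq hb.continuous h0 ht.2.le le_rfl
  rw [hmap.finish, heq] at hcal
  have hint : ∫ z in t..L, lagrangian b (φ z) (deriv φ z) = 0 := by linarith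
  have hac := hmap.absCont_sub h0 ht.2.le le_rfl
  have hc : ContinuousOn φ (Icc t L) := hmap.continuousOn.mono (Icc_subset_Icc_left h0.le)
  rw [intervalIntegral.integral_eq_zero_iff_of_le_of_nonneg_ae ht.2.le
    (Eventually.of_forall fun _ => lagrangian_nonneg _ _ _)
    (intervalIntegrable_lagrangian hb.continuous ht.2.le hc
      (intervalIntegrable_deriv_of_absolutelyContinuous hac)), EventuallyEq,
    ae_restrict_iff' measurableSet_Ioc] at hint
  refine hmap.not_tendsto_avgMomentum_zero hb hO hy hbasin hnc ?_
  refine tendsto_const_nhds.congr' ?_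
  filter_upwards [Ioo_mem_nhdsLT ht.2] with s hs
  have : ∫ z in s..L, momentum b φ z = 0 := by
    rw [intervalIntegral.integral_congr_ae (g := fun _ => 0), intervalIntegral.integral_zero]
    rw [uIoc_of_le hs.2.le]
    filter_upwards [hint] with z hz hzm
    have h1 := norm_momentum_sq b φ z
    have h2 : lagrangian b (φ z) (deriv φ z) = 0 := hz ⟨hs.1.trans hzm.1, hzm.2⟩
    rw [h2, mul_zero] at h1
    exact norm_eq_zero.1 (pow_eq_zero_iff two_ne_zero |>.1 h1)
  rw [avgMomentum, this, smul_zero]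

end

end Quasipotential

namespace Quasipotential

/-! ### Plane geometry -/

/-- The signed area spanned by two plane vectors. -/
def cross (u v : Plane) : ℝ := u 0 * v 1 - u 1 * v 0

@[fun_prop]
theorem continuous_cross_left (v : Plane) : Continuous fun u => cross u v := by
  unfold cross; fun_prop

@[fun_prop]
theorem continuous_cross_right (u : Plane) : Continuous (cross u) := by
  unfold cross; fun_prop

theorem cross_smul_left (c : ℝ) (u v : Plane) : cross (c • u) v = c * cross u v := by
  simp only [cross, PiLp.smul_apply, smul_eq_mul]; ring

theorem cross_smul_right (c : ℝ) (u v : Plane) : cross u (c • v) = c * cross u v := by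
  simp only [cross, PiLp.smul_apply, smul_eq_mul]; ring

theorem eq_cross_smul_add {u v : Plane} (h : cross u v ≠ 0) (z : Plane) :
    z = (cross z v / cross u v) • u + (cross u z / cross u v) • v := by
  ext i
  simp only [PiLp.add_apply, PiLp.smul_apply, smul_eq_mul]
  field_simp
  fin_cases i <;> simp only [cross, Fin.zero_eta, Fin.mk_one] <;> ring

theorem cross_direction (α β : ℝ) : cross (direction α) (direction β) = Real.sin (β - α) := by
  simp [cross, direction, Real.sin_sub]; ring

theorem inner_direction (α β : ℝ) :
    inner ℝ (direction α) (direction β) = Real.cos (β - α) := by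
  simp [direction, PiLp.inner_apply, Fin.sum_univ_two, Real.cos_sub]

theorem norm_direction (α : ℝ) : ‖direction α‖ = 1 := by
  have h := inner_direction α α
  rw [real_inner_self_eq_norm_sq, sub_self, Real.cos_zero] at h
  exact (pow_eq_one_iff_of_nonneg (norm_nonneg _) two_ne_zero).1 h

theorem continuous_direction : Continuous direction := by
  unfold direction
  exact (PiLp.continuous_toLp 2 _).comp (continuous_pi fun i => by
    fin_cases i <;> simp <;> fun_prop)

theorem direction_add_int_mul (α : ℝ) (m : ℤ) : direction (α + m * (2 * Real.pi)) = direction α := by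
  simp [direction, Real.cos_add_int_mul_two_pi, Real.sin_add_int_mul_two_pi]

theorem exists_eq_direction {w : Plane} (hw : ‖w‖ = 1) : ∃ α, w = direction α := by
  set z : ℂ := ⟨w 0, w 1⟩ with hz
  have hn : ‖z‖ = 1 := by
    rw [Complex.norm_def, Complex.normSq_apply, ← hw, EuclideanSpace.norm_eq, Fin.sum_univ_two]
    simp [hz, sq]
  have hz0 : z ≠ 0 := norm_ne_zero_iff.1 (by rw [hn]; exact one_ne_zero)
  refine ⟨z.arg, ?_⟩
  ext i
  fin_cases i
  · have h := Complex.cos_arg hz0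
    rw [hn, div_one] at h
    simpa [direction] using h.symm
  · have h := Complex.sin_arg z
    rw [hn, div_one] at h
    simpa [direction] using h.symm

/-! ### Rotationally ordered directions -/

theorem exists_le_lt_succ {θ : ℤ → ℝ} (hθ : StrictMono θ) {x : ℝ} {i j : ℤ} (hi : θ i ≤ x)
    (hj : x < θ j) : ∃ k, θ k ≤ x ∧ x < θ (k + 1) := by
  obtain ⟨k, hk, hmax⟩ := Int.exists_greatest_of_bdd (P := fun k => θ k ≤ x)
    ⟨j, fun z hz => (hθ.lt_iff_lt.1 (lt_of_le_of_lt hz hj)).le⟩ ⟨i, hi⟩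
  refine ⟨k, hk, lt_of_not_ge fun h => ?_⟩
  have := hmax _ h
  omega

/-- The vector `w` lies strictly between `u` and `v`, which enclose less than a half-turn. -/
structure StrictlyBetween (u w v : Plane) : Prop where
  left : 0 < cross u w
  right : 0 < cross w v
  inner_left : inner ℝ u v < (inner ℝ u w : ℝ)
  inner_right : inner ℝ u v < (inner ℝ v w : ℝ)

theorem strictlyBetween_direction {α β γ : ℝ} (h1 : α < γ) (h2 : γ < β) (h3 : β - α < Real.pi) :
    StrictlyBetween (direction α) (direction γ) (direction β) where
  left := by
    rw [cross_direction]; exact Real.sin_pos_of_pos_of_lt_pi (by linarith) (by linarith)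
  right := by
    rw [cross_direction]; exact Real.sin_pos_of_pos_of_lt_pi (by linarith) (by linarith)
  inner_left := by
    rw [inner_direction, inner_direction]
    exact Real.cos_lt_cos_of_nonneg_of_le_pi (by linarith) h3.le (by linarith)
  inner_right := by
    rw [inner_direction, inner_direction, ← Real.cos_neg (γ - β)]
    exact Real.cos_lt_cos_of_nonneg_of_le_pi (by linarith) h3.le (by linarith)

section

variable {D : ℤ → Plane} (hD : RotationallyOrdered D)
include hD

theorem RotationallyOrdered.norm_eq_one (k : ℤ) : ‖D k‖ = 1 := by
  obtain ⟨θ, h, -⟩ := hD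
  rw [h, norm_direction]

theorem RotationallyOrdered.cross_pos (k : ℤ) : 0 < cross (D k) (D (k + 1)) := by
  obtain ⟨θ, h, hm, hpi, -⟩ := hD
  rw [h, h, cross_direction]
  exact Real.sin_pos_of_pos_of_lt_pi (sub_pos.2 (hm (by omega))) (hpi k)

theorem RotationallyOrdered.inner_lt_one (k : ℤ) : inner ℝ (D k) (D (k + 1)) < (1 : ℝ) := by
  obtain ⟨θ, h, hm, hpi, -⟩ := hD
  rw [h, h, inner_direction, ← Real.cos_zero]
  exact Real.cos_lt_cos_of_nonneg_of_le_pi le_rfl (hpi k).le (sub_pos.2 (hm (by omega)))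

/-- The half-open angular intervals between neighbours cover the circle, except for the accumulation
direction of an infinite collection. -/
theorem RotationallyOrdered.exists_between_or_tendsto {w : Plane} (hw : ‖w‖ = 1) :
    (∃ k, w = D k ∨ StrictlyBetween (D k) w (D (k + 1))) ∨ Tendsto D atBot (𝓝 w) := by
  obtain ⟨θ, hθ, hm, hpi, hor⟩ := hD
  have key : ∀ {x i j}, θ i ≤ x → x < θ j →
      ∃ k, direction x = D k ∨ StrictlyBetween (D k) (direction x) (D (k + 1)) := by
    intro x i j hi hj
    obtain ⟨k, hk1, hk2⟩ := exists_le_lt_succ hm hi hj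
    refine ⟨k, ?_⟩
    rw [hθ, hθ]
    rcases hk1.eq_or_lt with h | h
    · exact Or.inl (by rw [h])
    · exact Or.inr (strictlyBetween_direction h hk2 (hpi k))
  obtain ⟨x, rfl⟩ := exists_eq_direction hw
  have hpi2 := Real.two_pi_pos
  rcases hor with ⟨n, hn, hper⟩ | ⟨a, ha, hb⟩
  · left
    have hmul : ∀ m : ℕ, θ (n * m) = θ 0 + m * (2 * Real.pi) ∧
        θ (-(n * m)) = θ 0 - m * (2 * Real.pi) := by
      intro m
      induction m with
      | zero => simp
      | succ m ih =>
        have h1 := hper (n * m)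
        have h2 := hper (-(n * (m + 1)))
        rw [show -(n * ((m : ℤ) + 1)) + n = -(n * m) by ring] at h2
        push_cast
        rw [show n * ((m : ℤ) + 1) = n * m + n by ring] at h2 ⊢
        constructor
        · rw [h1, ih.1]; ring
        · linarith [ih.2]
    obtain ⟨m₁, h₁⟩ := exists_nat_gt ((x - θ 0) / (2 * Real.pi))
    obtain ⟨m₂, h₂⟩ := exists_nat_gt ((θ 0 - x) / (2 * Real.pi))
    rw [div_lt_iff₀ hpi2] at h₁ h₂
    exact key (i := -(n * m₂)) (j := n * m₁) (by rw [(hmul m₂).2]; linarith)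
      (by rw [(hmul m₁).1]; linarith)
  -- The angle is reduced to `[a, a + 2π)`; its left end is the only angle that the list does not
  -- bracket.
  · set x' := toIcoMod hpi2 a x with hx'
    have hdir : direction x = direction x' := by
      have h1 := toIcoMod_add_toIcoDiv_zsmul hpi2 a x
      rw [zsmul_eq_mul] at h1
      rw [← h1, direction_add_int_mul]
    have hmem := toIcoMod_mem_Ico hpi2 a x
    rw [hdir]
    rcases hmem.1.eq_or_lt with h | h
    · right
      rw [hx', ← h]
      exact (((continuous_direction.tendsto a).comp ha).congr fun k => (hθ k).symm)
    · left
      obtain ⟨i, hi⟩ := (ha.eventually (gt_mem_nhds h)).exists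
      obtain ⟨j, hj⟩ := (hb.eventually (lt_mem_nhds hmem.2)).exists
      exact key hi.le hj

end

/-! ### Crossing the segment between two directions -/

/-- Here `g` is the sum of the coordinates of `φ t - y` in the sector containing it. Level `h` of
`g` is the segment, and `g` dominates the distance to `y`. The crossing time is the last time at
which `g ≥ h`. Two sectors are allowed because the path may change sides. -/
theorem passesBetween_or_passesBetween {φ : ℝ → Plane} {s L h : ℝ} {y u v u' v' : Plane}
    (hs : 0 ≤ s) (hsL : s < L)
    (hy : φ L = y) (hu : ‖u‖ = 1) (hv : ‖v‖ = 1) (hu' : ‖u'‖ = 1) (hv' : ‖v'‖ = 1) {g : ℝ → ℝ}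
    (hg : ContinuousOn g (Icc s L)) (hgL : g L = 0)
    (hsec : ∀ t ∈ Ico s L,
      (∃ α β, 0 ≤ α ∧ 0 ≤ β ∧ φ t - y = α • u + β • v ∧ g t = α + β) ∨
      (∃ α β, 0 ≤ α ∧ 0 ≤ β ∧ φ t - y = α • u' + β • v' ∧ g t = α + β))
    (hh : 0 < h) (hgs : h ≤ g s) :
    PassesBetween φ L h (y + h • u) (y + h • v) ∨
      PassesBetween φ L h (y + h • u') (y + h • v') := by
  set S : Set ℝ := Icc s L ∩ g ⁻¹' Ici h with hS
  have hSc : IsCompact S := isCompact_Icc.of_isClosed_subset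
    (hg.preimage_isClosed_of_isClosed isClosed_Icc isClosed_Ici) inter_subset_left
  have hSne : S.Nonempty := ⟨s, ⟨le_rfl, hsL.le⟩, hgs⟩
  have hr := hSc.sSup_mem hSne
  set r := sSup S with hrdef
  have hrL : r < L := lt_of_le_of_ne hr.1.2 fun h0 => by
    have : h ≤ g r := hr.2
    rw [h0, hgL] at this; linarith
  have hgr : g r = h := by
    obtain ⟨t, ht, hgt⟩ := intermediate_value_Icc' hrL.le (hg.mono (Icc_subset_Icc_left hr.1.1))
      (show h ∈ Icc (g L) (g r) from ⟨by rw [hgL]; exact hh.le, hr.2⟩)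
    have htS : t ∈ S := ⟨⟨hr.1.1.trans ht.1, ht.2⟩, hgt.ge⟩
    have htr : t = r := le_antisymm (le_csSup hSc.bddAbove htS) ht.1
    rw [← htr, hgt]
  have hle : ∀ t ∈ Icc r L, g t ≤ h := fun t ht => by
    rcases ht.1.eq_or_lt with h0 | h0
    · rw [← h0, hgr]
    · by_contra hlt
      exact absurd (le_csSup hSc.bddAbove
        (show t ∈ S from ⟨⟨hr.1.1.trans ht.1, ht.2⟩, (not_le.1 hlt).le⟩)) (not_le.2 h0)
  have hnorm : ∀ {α β : ℝ} {p q : Plane}, ‖p‖ = 1 → ‖q‖ = 1 → 0 ≤ α → 0 ≤ β →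
      ‖α • p + β • q‖ ≤ α + β := fun hp hq hα hβ => by
    refine (norm_add_le _ _).trans ?_
    rw [norm_smul, norm_smul, hp, hq, Real.norm_eq_abs, Real.norm_eq_abs, abs_of_nonneg hα,
      abs_of_nonneg hβ, mul_one, mul_one]
  have hball : ∀ t ∈ Icc r L, φ t ∈ Metric.closedBall (φ L) h := fun t ht => by
    rcases ht.2.eq_or_lt with h0 | h0
    · rw [h0]; exact Metric.mem_closedBall_self hh.le
    · rw [mem_closedBall_iff_norm, hy]
      have hgt := hle t ht
      rcases hsec t ⟨hr.1.1.trans ht.1, h0⟩ with ⟨α, β, hα, hβ, heq, hsum⟩ | ⟨α, β, hα, hβ, heq, hsum⟩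
      · rw [heq]; linarith [hnorm hu hv hα hβ]
      · rw [heq]; linarith [hnorm hu' hv' hα hβ]
  have hseg : ∀ {α β : ℝ} {p q : Plane}, 0 ≤ α → 0 ≤ β → φ r - y = α • p + β • q →
      g r = α + β → φ r ∈ segment ℝ (y + h • p) (y + h • q) := fun {α β p q} hα hβ heq hsum => by
    rw [hgr] at hsum
    refine ⟨α / h, β / h, by positivity, by positivity, ?_, ?_⟩
    · rw [← add_div, ← hsum, div_self hh.ne']
    · rw [← sub_add_cancel (φ r) y, heq, smul_add, smul_add, smul_smul, smul_smul,
        div_mul_cancel₀ _ hh.ne', div_mul_cancel₀ _ hh.ne']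
      have h1 : (α / h) • y + (β / h) • y = y := by
        rw [← add_smul, ← add_div, ← hsum, div_self hh.ne', one_smul]
      nth_rewrite 3 [← h1]
      abel
  rcases hsec r ⟨hr.1.1, hrL⟩ with ⟨α, β, hα, hβ, heq, hsum⟩ | ⟨α, β, hα, hβ, heq, hsum⟩
  · exact Or.inl ⟨r, ⟨hs.trans hr.1.1, hrL⟩, hseg hα hβ heq hsum, hball⟩
  · exact Or.inr ⟨r, ⟨hs.trans hr.1.1, hrL⟩, hseg hα hβ heq hsum, hball⟩

section

variable {φ : ℝ → Plane} {L : ℝ} {y w : Plane}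

theorem exists_cross_pos (hL : 0 < L) (hnc : ∀ t ∈ Ioo 0 L, 0 < pathLength φ t L)
    (hw : Tendsto (fun t => (pathLength φ t L)⁻¹ • (φ t - y)) (𝓝[<] L) (𝓝 w))
    {u v : Plane} (huw : 0 < cross u w) (hwv : 0 < cross w v) :
    ∃ s ∈ Ioo 0 L, ∀ t ∈ Ico s L, 0 < cross u (φ t - y) ∧ 0 < cross (φ t - y) v := by
  have e1 := ((continuous_cross_right u).tendsto w).comp hw |>.eventually (lt_mem_nhds huw)
  have e2 := ((continuous_cross_left v).tendsto w).comp hw |>.eventually (lt_mem_nhds hwv)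
  obtain ⟨s, hs, hsub⟩ := (mem_nhdsLT_iff_exists_mem_Ico_Ioo_subset hL).1
    ((e1.and e2).and (Ioo_mem_nhdsLT hL))
  set s' := (s + L) / 2 with hs'
  have hs1 : s < s' := by rw [hs']; linarith [hs.2]
  have hs2 : s' < L := by rw [hs']; linarith [hs.2]
  have hs0 : 0 < s' := hs.1.trans_lt hs1
  refine ⟨s', ⟨hs0, hs2⟩, fun t ht => ?_⟩
  obtain ⟨⟨h1, h2⟩, h3⟩ := hsub ⟨hs1.trans_le ht.1, ht.2⟩
  have hl := inv_pos.2 (hnc t h3)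
  simp only [Function.comp_apply, cross_smul_left, cross_smul_right] at h1 h2
  exact ⟨(mul_pos_iff_of_pos_left hl).1 h1, (mul_pos_iff_of_pos_left hl).1 h2⟩

theorem eventually_passesBetween (hL : 0 < L) (hφ : ContinuousOn φ (Icc 0 L)) (hy : φ L = y)
    (hnc : ∀ t ∈ Ioo 0 L, 0 < pathLength φ t L)
    (hw : Tendsto (fun t => (pathLength φ t L)⁻¹ • (φ t - y)) (𝓝[<] L) (𝓝 w))
    {u v : Plane} (hu : ‖u‖ = 1) (hv : ‖v‖ = 1) (huv : 0 < cross u v)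
    (huw : 0 < cross u w) (hwv : 0 < cross w v) :
    ∀ᶠ h in 𝓝[>] (0 : ℝ), PassesBetween φ L h (y + h • u) (y + h • v) := by
  obtain ⟨s', ⟨hs0, hs2⟩, hpos⟩ := exists_cross_pos hL hnc hw huw hwv
  set g : ℝ → ℝ := fun t => cross (φ t - y) v / cross u v + cross u (φ t - y) / cross u v with hg
  have hφ' : ContinuousOn (fun t => φ t - y) (Icc s' L) :=
    (hφ.mono (Icc_subset_Icc_left hs0.le)).sub continuousOn_const
  have hgc : ContinuousOn g (Icc s' L) :=
    (((continuous_cross_left v).comp_continuousOn hφ').div_const _).add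
      (((continuous_cross_right u).comp_continuousOn hφ').div_const _)
  have hgs : 0 < g s' := by
    obtain ⟨h1, h2⟩ := hpos s' ⟨le_rfl, hs2⟩
    simp only [hg]; positivity
  filter_upwards [Ioc_mem_nhdsGT hgs] with h hh
  have := passesBetween_or_passesBetween (u' := u) (v' := v) hs0.le hs2 hy hu hv hu hv hgc
    (by simp [hg, hy, cross]) (fun t ht => by
      obtain ⟨h1, h2⟩ := hpos t ht
      exact Or.inl ⟨_, _, by positivity, by positivity, eq_cross_smul_add huv.ne' _, rfl⟩)
    hh.1 hh.2
  simpa using this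

/-- When `w` is itself a listed direction, the path stays near the ray along `w` but may lie on
either side of it, depending on the time. -/
theorem eventually_passesBetween_or (hL : 0 < L) (hφ : ContinuousOn φ (Icc 0 L)) (hy : φ L = y)
    (hnc : ∀ t ∈ Ioo 0 L, 0 < pathLength φ t L)
    (hw : Tendsto (fun t => (pathLength φ t L)⁻¹ • (φ t - y)) (𝓝[<] L) (𝓝 w))
    {u v : Plane} (hu : ‖u‖ = 1) (hv : ‖v‖ = 1) (hwn : ‖w‖ = 1)
    (huw : 0 < cross u w) (hwv : 0 < cross w v) :
    ∀ᶠ h in 𝓝[>] (0 : ℝ), PassesBetween φ L h (y + h • u) (y + h • w) ∨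
      PassesBetween φ L h (y + h • w) (y + h • v) := by
  obtain ⟨s', ⟨hs0, hs2⟩, hpos⟩ := exists_cross_pos hL hnc hw huw hwv
  -- The coordinate sums of the two sectors, glued along the line spanned by `w`, where they agree.
  set G : Plane → ℝ := fun z => if 0 ≤ cross w z then
    cross z v / cross w v + cross w z / cross w v else
    cross z w / cross u w + cross u z / cross u w with hG
  have hGc : Continuous G := by
    refine Continuous.if_le (by fun_prop) (by fun_prop) continuous_const (by fun_prop)
      fun z hz => ?_
    have hz' : cross z w = 0 := by
      have : cross z w = -cross w z := by unfold cross; ring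
      rw [this, ← hz, neg_zero]
    rw [← hz, hz', zero_div, zero_div, add_zero, zero_add, div_eq_div_iff hwv.ne' huw.ne']
    have hid : cross z v * cross u w - cross u z * cross w v = -(cross w z * cross u v) := by
      unfold cross; ring
    rw [← hz, zero_mul, neg_zero] at hid
    linarith
  have hφ' : ContinuousOn (fun t => φ t - y) (Icc s' L) :=
    (hφ.mono (Icc_subset_Icc_left hs0.le)).sub continuousOn_const
  have hneg : ∀ z, cross z w = -cross w z := fun z => by unfold cross; ring
  have hsec : ∀ t ∈ Ico s' L,
      (∃ α β, 0 ≤ α ∧ 0 ≤ β ∧ φ t - y = α • u + β • w ∧ G (φ t - y) = α + β) ∨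
      (∃ α β, 0 ≤ α ∧ 0 ≤ β ∧ φ t - y = α • w + β • v ∧ G (φ t - y) = α + β) := fun t ht => by
    obtain ⟨h1, h2⟩ := hpos t ht
    by_cases hc : 0 ≤ cross w (φ t - y)
    · exact Or.inr ⟨_, _, by positivity, by positivity, eq_cross_smul_add hwv.ne' _, if_pos hc⟩
    · have h3 : 0 ≤ cross (φ t - y) w := by rw [hneg]; linarith
      exact Or.inl ⟨_, _, by positivity, by positivity, eq_cross_smul_add huw.ne' _, if_neg hc⟩
  have hgs : 0 < G (φ s' - y) := by
    obtain ⟨h1, h2⟩ := hpos s' ⟨le_rfl, hs2⟩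
    simp only [hG]
    split_ifs with hc
    · positivity
    · have h3 : 0 < cross (φ s' - y) w := by rw [hneg]; linarith
      positivity
  filter_upwards [Ioc_mem_nhdsGT hgs] with h hh
  exact passesBetween_or_passesBetween hs0.le hs2 hy hu hwn hwn hv
    (hGc.comp_continuousOn hφ') (by simp [hG, hy, cross]) hsec hh.1 hh.2

end

end Quasipotential

namespace Quasipotential

/-! ### Descent of the quasipotential, and the backward tangent -/

section

variable {b : Plane → Plane} {O y : Plane} {L : ℝ} {φ : ℝ → Plane}

theorem lt_of_first_order_bounds {VA Vz Vy n β h C i j m c K : ℝ} (hh : 0 < h) (hβ : 0 ≤ β)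
    (hK : 0 ≤ K) (hC : 0 ≤ C) (hc : c * β = β * i + j)
    (hE : h * (2 * K * (1 + C) ^ 2 + 2 * K * C ^ 2) < β * c / 2)
    (hn : n ≤ h * (C - i + c / 2)) (hn' : n ≤ h * (1 + C))
    (hline : VA ≤ Vz + (n * β - (h * j + m) + 2 * (K * (h * (1 + C))) * n))
    (hge : Vz + β * (C * h) - m - 2 * K * (C * h) ^ 2 ≤ Vy) : VA < Vy := by
  have h1 : n * β ≤ h * (C - i + c / 2) * β := by gcongr
  have h2 : 2 * (K * (h * (1 + C))) * n ≤ 2 * (K * (h * (1 + C))) * (h * (1 + C)) := by gcongr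
  have h3 := mul_lt_mul_of_pos_left hE hh
  have hj : j = c * β - β * i := by linarith
  subst hj
  linarith

/-- Leaving the path at `z`, with length `C h` to go, and heading straight for `y + hu` replaces the
cost `‖b y‖ C h` by about `‖b y‖ h ‖u - C w‖`, while the inner product term gains `h u·b y`. For
large `C`, `‖u - C w‖` is close to `C - u·w`. -/
theorem IsMAP.eventually_quasipotential_lt (hb : ContDiff ℝ ∞ b) (hmap : IsMAP b O y L φ)
    (hnc : ∀ t ∈ Ioo 0 L, 0 < pathLength φ t L) (hy : b y ≠ 0) {w : Plane} (hwn : ‖w‖ = 1)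
    (hw : Tendsto (fun t => (pathLength φ t L)⁻¹ • (φ t - y)) (𝓝[<] L) (𝓝 w))
    {u : Plane} (hu : ‖u‖ = 1) (huw : 0 < ‖b y‖ * inner ℝ u w + inner ℝ u (b y)) :
    ∀ᶠ h in 𝓝[>] (0 : ℝ), quasipotential b O (y + h • u) < quasipotential b O y := by
  obtain ⟨R, K, hK, hR⟩ := exists_ball_lipschitzOnWith hb hmap.continuousOn
  have hyp : 0 < ‖b y‖ := norm_pos_iff.2 hy
  set c : ℝ := (‖b y‖ * inner ℝ u w + inner ℝ u (b y)) / ‖b y‖ with hc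
  have hcpos : 0 < c := div_pos huw hyp
  have hcb : c * ‖b y‖ = ‖b y‖ * inner ℝ u w + inner ℝ u (b y) := div_mul_cancel₀ _ hyp.ne'
  -- The error in `‖u - C w‖ ≤ C - u·w + 1/(2C)` is then `c/4`. Allowing `c/2` leaves room for the
  -- passage to the limit and still gives a net gain of `‖b y‖ c h / 2`, against an error of order
  -- `h²`.
  set C : ℝ := 2 / c with hC
  have hCpos : 0 < C := by positivity
  -- a point of the path at distance `C h` before the endpoint is a good starting point
  have hlim : Tendsto (fun t => ‖u - C • ((pathLength φ t L)⁻¹ • (φ t - y))‖) (𝓝[<] L)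
      (𝓝 ‖u - C • w‖) := (tendsto_const_nhds.sub (hw.const_smul C)).norm
  have hlt : ‖u - C • w‖ < C - inner ℝ u w + c / 2 := by
    have hne : -(C • w) ≠ 0 := by
      rw [neg_ne_zero, ← norm_ne_zero_iff, norm_smul, hwn, mul_one, norm_ne_zero_iff]
      exact hCpos.ne'
    have h1 := norm_add_le_first_order hne u
    rw [norm_neg, norm_smul, hwn, mul_one, Real.norm_eq_abs, abs_of_pos hCpos, inner_neg_left,
      inner_smul_left, hu, real_inner_comm] at h1
    simp only [conj_trivial] at h1
    have h2 : -(C * inner ℝ u w) / C = -inner ℝ u w := by field_simp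
    have h3 : (1 : ℝ) ^ 2 / (2 * C) = c / 4 := by rw [hC]; field_simp; norm_num
    rw [h2, h3, neg_add_eq_sub] at h1
    linarith
  obtain ⟨s, hs, hsub⟩ := (mem_nhdsLT_iff_exists_mem_Ico_Ioo_subset hmap.pos).1
    ((hlim.eventually (gt_mem_nhds hlt)).and (Ioo_mem_nhdsLT hmap.pos))
  set s' := (s + L) / 2 with hs'
  have hs1 : s < s' := by rw [hs']; linarith [hs.2]
  have hs2 : s' < L := by rw [hs']; linarith [hs.2]
  have hs0 : 0 < s' := hs.1.trans_lt hs1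
  have hls := hnc s' ⟨hs0, hs2⟩
  have hlc : ContinuousOn (fun t => pathLength φ t L) (Icc s' L) :=
    continuousOn_integral_left hs2.le (intervalIntegrable_deriv_of_absolutelyContinuous
      (hmap.absCont_sub hs0 hs2.le le_rfl)).norm
  set E : ℝ := 2 * K * (1 + C) ^ 2 + 2 * K * C ^ 2 with hE
  have hE0 : 0 ≤ E := by positivity
  have hyR : y ∈ Metric.closedBall (0 : Plane) (R - 1) := by
    rw [mem_closedBall_zero_iff, ← hmap.finish]; exact hR L ⟨hmap.pos.le, le_rfl⟩
  have hyR' : y ∈ Metric.closedBall (0 : Plane) R := Metric.closedBall_subset_closedBall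
    (by linarith) hyR
  have hsmall : 0 < min (pathLength φ s' L / C) (min (1 / (1 + C)) (‖b y‖ * c / 2 / (E + 1))) := by
    positivity
  filter_upwards [Ioo_mem_nhdsGT hsmall] with h hh
  obtain ⟨hh1, hh2, hh3⟩ := (lt_min_iff.1 hh.2).imp_right lt_min_iff.1
  have hh0 : 0 < h := hh.1
  rw [lt_div_iff₀ hCpos] at hh1
  rw [lt_div_iff₀ (by positivity)] at hh2 hh3
  obtain ⟨t, ht, htl⟩ := intermediate_value_Icc' hs2.le hlc
    (show C * h ∈ Icc (pathLength φ L L) (pathLength φ s' L) from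
      ⟨by rw [pathLength, intervalIntegral.integral_same]; positivity, by linarith⟩)
  simp only at htl
  have htL : t < L := lt_of_le_of_ne ht.2 fun h0 => by
    rw [h0, pathLength, intervalIntegral.integral_same] at htl
    exact (mul_pos hCpos hh0).ne htl
  obtain ⟨hV, ht0⟩ := hsub ⟨hs1.trans_le ht.1, htL⟩
  set l := pathLength φ t L with hl
  have hlpos : 0 < l := hnc t ht0
  set A := y + h • u with hA
  have hAz : A - φ t = h • (u - C • (l⁻¹ • (φ t - y))) := by
    have h1 : φ t - y = h • (C • (l⁻¹ • (φ t - y))) := by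
      rw [smul_smul, smul_smul, mul_comm h C, ← htl, mul_inv_cancel₀ hlpos.ne', one_smul]
    rw [smul_sub, ← h1, hA]; abel
  have hAn : ‖A - φ t‖ ≤ h * (C - inner ℝ u w + c / 2) := by
    rw [hAz, norm_smul, Real.norm_eq_abs, abs_of_pos hh0]; gcongr
  have hzy : ‖φ t - y‖ ≤ C * h := by
    have := norm_sub_le_pathLength_of_mem (hmap.absCont_sub ht0.1 ht0.2.le le_rfl)
      (left_mem_Icc.2 ht0.2.le)
    rw [hmap.finish] at this
    exact this.trans htl.le
  have hAy : ‖A - y‖ = h := by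
    rw [hA, add_sub_cancel_left, norm_smul, hu, mul_one, Real.norm_eq_abs, abs_of_pos hh0]
  have hAz' : ‖A - φ t‖ ≤ h * (1 + C) := by
    have := norm_sub_le_norm_sub_add_norm_sub A y (φ t)
    rw [norm_sub_rev y] at this; linarith
  have hline := toReal_quasipotential_le_line hb.continuous (O := O) (x := φ t) (x' := A) (c := y)
    (η := K * (h * (1 + C))) fun z hz => by
      have h1 : z ∈ Metric.closedBall y (h * (1 + C)) := by
        refine (convex_closedBall _ _).segment_subset ?_ ?_ hz
        · rw [mem_closedBall_iff_norm]; linarith only [hzy, hh0]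
        · rw [mem_closedBall_iff_norm, hAy]; exact le_mul_of_one_le_right hh0.le (by linarith)
      rw [mem_closedBall_iff_norm] at h1
      have h2 : z ∈ Metric.closedBall (0 : Plane) R := by
        rw [mem_closedBall_zero_iff] at hyR ⊢
        have := norm_add_le (z - y) y
        rw [sub_add_cancel] at this
        linarith
      exact (hK.norm_sub_le h2 hyR').trans (by gcongr)
  have hge := hmap.toReal_quasipotential_ge hb.continuous hK hR ht0
  have hlag : lagrangian b y (A - φ t) = ‖A - φ t‖ * ‖b y‖ - inner ℝ (A - φ t) (b y) := rfl
  have hin : inner ℝ (A - φ t) (b y) = h * inner ℝ u (b y) + inner ℝ (y - φ t) (b y) := by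
    rw [hA, show y + h • u - φ t = h • u + (y - φ t) by abel, inner_add_left, inner_smul_left]
    simp
  rw [hlag, hin] at hline
  rw [← hl, htl] at hge
  have hmain : (quasipotential b O A).toReal < (quasipotential b O y).toReal :=
    lt_of_first_order_bounds hh0 hyp.le K.coe_nonneg hCpos.le hcb (by
      rw [hE, mul_add] at hh3; linarith only [hh3, hh0]) hAn hAz' hline hge
  exact (ENNReal.toReal_lt_toReal (quasipotential_lt_top hb.continuous _ _).ne
    (quasipotential_lt_top hb.continuous _ _).ne).1 hmain

/-- Length and chord are asymptotically equal since `‖w‖ = 1`. As the path does not meet its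
endpoint earlier, points of its image close to the endpoint come from late times only. -/
theorem isBackwardTangent_of_tendsto {w : Plane} (hL : 0 < L) (hφ : ContinuousOn φ (Icc 0 L))
    (hne : ∀ t ∈ Ico 0 L, φ t ≠ φ L) (hnc : ∀ t ∈ Ioo 0 L, 0 < pathLength φ t L) (hwn : ‖w‖ = 1)
    (hw : Tendsto (fun t => (pathLength φ t L)⁻¹ • (φ t - φ L)) (𝓝[<] L) (𝓝 w)) :
    IsBackwardTangent φ L w := by
  have hdir : Tendsto (fun t => ‖φ t - φ L‖⁻¹ • (φ t - φ L)) (𝓝[<] L) (𝓝 w) := by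
    have h1 := (hw.norm.inv₀ (by rw [hwn]; exact one_ne_zero)).smul hw
    rw [hwn, inv_one, one_smul] at h1
    refine h1.congr' ?_
    filter_upwards [Ioo_mem_nhdsLT hL] with t ht
    have hl := hnc t ht
    rw [norm_smul, norm_inv, Real.norm_eq_abs, abs_of_pos hl, smul_smul, mul_inv, inv_inv]
    congr 1
    field_simp
  rw [IsBackwardTangent, Metric.tendsto_nhds]
  intro ε hε
  obtain ⟨s, hs, hsub⟩ := (mem_nhdsLT_iff_exists_mem_Ico_Ioo_subset hL).1
    (hdir.eventually (Metric.ball_mem_nhds w hε))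
  have hdist : ContinuousOn (fun t => dist (φ t) (φ L)) (Icc 0 s) :=
    (continuous_id.dist continuous_const).comp_continuousOn
      (hφ.mono (Icc_subset_Icc_right hs.2.le))
  -- By compactness the path stays a positive distance away from its endpoint up to time `s`.
  obtain ⟨m, hm, hmin⟩ := isCompact_Icc.exists_isMinOn (nonempty_Icc.2 hs.1) hdist
  have hpos : 0 < dist (φ m) (φ L) := dist_pos.2 (hne m ⟨hm.1, hm.2.trans_lt hs.2⟩)
  filter_upwards [inter_mem_nhdsWithin _ (Metric.ball_mem_nhds (φ L) hpos)] with z hz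
  obtain ⟨⟨⟨t, ht, rfl⟩, hzL⟩, hzb⟩ := hz
  rcases le_or_gt t s with hts | hts
  · have hle : dist (φ m) (φ L) ≤ dist (φ t) (φ L) := hmin ⟨ht.1, hts⟩
    exact absurd hle (not_le.2 hzb)
  · exact hsub ⟨hts, lt_of_le_of_ne ht.2 fun h => hzL (by rw [h]; rfl)⟩

/-- A minimum action path may rest at `y` before time `L`. Cutting off the rest makes all remaining
lengths positive, so that one can divide by them. -/
theorem IsMAP.exists_last_arrival (hb : Continuous b) (hmap : IsMAP b O y L φ) (hyO : y ≠ O) :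
    ∃ L', IsMAP b O y L' φ ∧ L' ≤ L ∧ (∀ t ∈ Icc L' L, φ t = y) ∧
      ∀ t ∈ Ioo 0 L', 0 < pathLength φ t L' := by
  set N : Set ℝ := {t | t ∈ Icc 0 L ∧ φ t ≠ y} with hN
  have h0N : (0 : ℝ) ∈ N := ⟨⟨le_rfl, hmap.pos.le⟩, by rw [hmap.start]; exact hyO.symm⟩
  have hbdd : BddAbove N := ⟨L, fun t ht => ht.1.2⟩
  set T := sSup N with hT
  have hT0 : 0 ≤ T := le_csSup hbdd h0N
  have hTL : T ≤ L := csSup_le ⟨0, h0N⟩ fun t ht => ht.1.2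
  have hafter : ∀ t, T < t → t ≤ L → φ t = y := fun t h1 h2 => by
    by_contra hne
    exact absurd (le_csSup hbdd (show t ∈ N from ⟨⟨hT0.trans h1.le, h2⟩, hne⟩)) (not_le.2 h1)
  have hTy : φ T = y := by
    rcases hTL.eq_or_lt with h | h
    · rw [h, hmap.finish]
    · have h1 : Tendsto φ (𝓝[>] T) (𝓝 (φ T)) := (hmap.continuousOn T ⟨hT0, hTL⟩).mono_left
        (nhdsWithin_le_of_mem (mem_of_superset (Icc_mem_nhdsGT h) (Icc_subset_Icc_left hT0)))
      refine tendsto_nhds_unique h1 (tendsto_const_nhds.congr' ?_)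
      filter_upwards [Ioc_mem_nhdsGT h] with t ht using (hafter t ht.1 ht.2).symm
  have hTpos : 0 < T := lt_of_le_of_ne hT0 fun h => h0N.2 (by rw [h, hTy])
  have hmapT := hmap.of_le hb ⟨hTpos, hTL⟩
  rw [hTy] at hmapT
  refine ⟨T, hmapT, hTL, fun t ht => ?_, fun t ht => ?_⟩
  · rcases ht.1.eq_or_lt with h | h
    · rw [← h, hTy]
    · exact hafter t h ht.2
  · obtain ⟨z, hz, htz⟩ := exists_lt_of_lt_csSup ⟨0, h0N⟩ ht.2
    have h1 := norm_sub_le_pathLength_of_mem (hmapT.absCont_sub ht.1 ht.2.le le_rfl)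
      ⟨htz.le, le_csSup hbdd hz⟩
    rw [hTy] at h1
    exact (norm_pos_iff.2 (sub_ne_zero.2 hz.2)).trans_le h1

theorem PassesBetween.of_le {L' h : ℝ} {A B : Plane} (hL : L' ≤ L)
    (hconst : ∀ t ∈ Icc L' L, φ t = φ L) (hp : PassesBetween φ L' h A B) :
    PassesBetween φ L h A B := by
  obtain ⟨r, hr, hseg, hball⟩ := hp
  have hLL : φ L' = φ L := hconst L' ⟨le_rfl, hL⟩
  refine ⟨r, ⟨hr.1, hr.2.trans_le hL⟩, hseg, fun t ht => ?_⟩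
  rw [← hLL]
  rcases le_total t L' with h1 | h1
  · exact hball t ⟨ht.1, h1⟩
  · rw [hconst t ⟨h1, ht.2⟩, ← hLL]
    exact hball L' ⟨hr.2.le, le_rfl⟩

theorem IsBackwardTangent.of_le {L' : ℝ} {d : Plane} (hL' : 0 ≤ L') (hL : L' ≤ L)
    (hconst : ∀ t ∈ Icc L' L, φ t = φ L) (ht : IsBackwardTangent φ L' d) :
    IsBackwardTangent φ L d := by
  have hLL : φ L' = φ L := hconst L' ⟨le_rfl, hL⟩
  have himage : φ '' Icc 0 L \ {φ L} = φ '' Icc 0 L' \ {φ L} := by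
    rw [← Icc_union_Icc_eq_Icc hL' hL, image_union, union_sdiff_distrib]
    refine union_eq_self_of_subset_right ?_
    rintro _ ⟨⟨t, htm, rfl⟩, hne⟩
    exact absurd (hconst t htm) hne
  unfold IsBackwardTangent at ht ⊢
  rwa [himage, ← hLL]

end

/-- The theorem for a path that does not rest at its end: the position of `w` relative to `D`
decides which neighbours to take. -/
theorem exists_neighbours {b : Plane → Plane} (hb : ContDiff ℝ ∞ b)
    {O : Plane} (hO : IsStableAttractor b O) {y : Plane} (hy : b y ≠ 0)
    {L : ℝ} {φ : ℝ → Plane} (hφ : IsMAP b O y L φ) (hbasin : ∀ t ∈ Icc 0 L, φ t ∈ basin b O)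
    (hnc : ∀ t ∈ Ioo 0 L, 0 < pathLength φ t L)
    {bhat : Plane} (hbhat : bhat = ‖b y‖⁻¹ • b y) {D : ℤ → Plane} (hD : RotationallyOrdered D)
    (hacute : ∀ k, max (max (-inner ℝ (D k) bhat) (-inner ℝ (D (k + 1)) bhat)) 0 ≤
      inner ℝ (D k) (D (k + 1)))
    (htangent : ∀ k,
      (IsBackwardTangent φ L (D k) → -inner ℝ (D (k + 1)) bhat < inner ℝ (D k) (D (k + 1))) ∧
      (IsBackwardTangent φ L (D (k + 1)) → -inner ℝ (D k) bhat < inner ℝ (D k) (D (k + 1)))) :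
    ∃ k : ℤ,
      (∃ᶠ h in 𝓝[>] (0 : ℝ),
        PassesBetween φ L h (y + h • D k) (y + h • D (k + 1)) ∧
        quasipotential b O (y + h • D k) < quasipotential b O y ∧
        quasipotential b O (y + h • D (k + 1)) < quasipotential b O y) ∧
      ((∀ j, ¬ IsBackwardTangent φ L (D j)) →
        ∀ᶠ h in 𝓝[>] (0 : ℝ),
          PassesBetween φ L h (y + h • D k) (y + h • D (k + 1)) ∧
          quasipotential b O (y + h • D k) < quasipotential b O y ∧
          quasipotential b O (y + h • D (k + 1)) < quasipotential b O y) := by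
  have hyp : 0 < ‖b y‖ := norm_pos_iff.2 hy
  have hbn : ‖bhat‖ = 1 := by
    rw [hbhat, norm_smul, norm_inv, norm_norm, inv_mul_cancel₀ hyp.ne']
  have hby : b y = ‖b y‖ • bhat := by
    rw [hbhat, smul_smul, mul_inv_cancel₀ hyp.ne', one_smul]
  have hl : ∀ k, -inner ℝ (D k) bhat ≤ inner ℝ (D k) (D (k + 1)) := fun k =>
    (le_max_left _ _).trans ((le_max_left _ _).trans (hacute k))
  have hr : ∀ k, -inner ℝ (D (k + 1)) bhat ≤ inner ℝ (D k) (D (k + 1)) := fun k =>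
    (le_max_right _ _).trans ((le_max_left _ _).trans (hacute k))
  -- the directions can only accumulate at `-bhat`
  have hacc : Tendsto D atBot (𝓝 (-bhat)) := by
    refine (hD.exists_between_or_tendsto (w := -bhat) (by rwa [norm_neg])).resolve_left ?_
    rintro ⟨k, hk | hk⟩
    · have h1 := hl k
      rw [← inner_neg_right, hk, real_inner_self_eq_norm_sq, hD.norm_eq_one] at h1
      have := hD.inner_lt_one k
      linarith
    · have h1 := hk.inner_left
      rw [inner_neg_right] at h1
      exact absurd (hl k) (not_le.2 h1)
  obtain ⟨R, K, hK, hR⟩ := exists_ball_lipschitzOnWith hb hφ.continuousOn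
  obtain ⟨w, hwn, hw, hp⟩ := hφ.exists_tangent hb.continuous hK hR hnc hy
  have hwb : w ≠ -bhat := fun h => by
    refine hφ.not_tendsto_avgMomentum_zero hb hO hy hbasin hnc ?_
    have h0 : -(‖b y‖ • w + b y) = 0 := by
      nth_rewrite 2 [hby]
      rw [h, smul_neg, neg_add_cancel, neg_zero]
    rwa [h0] at hp
  have htan : IsBackwardTangent φ L w :=
    isBackwardTangent_of_tendsto hφ.pos hφ.continuousOn
      (fun t ht => by rw [hφ.finish]; exact hφ.ne_finish hb hO hy hbasin hnc ht) hnc hwn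
      (by rwa [hφ.finish])
  have hdesc : ∀ k, 0 < inner ℝ (D k) w + (inner ℝ (D k) bhat : ℝ) →
      ∀ᶠ h in 𝓝[>] (0 : ℝ), quasipotential b O (y + h • D k) < quasipotential b O y := by
    intro k hk
    refine hφ.eventually_quasipotential_lt hb hnc hy hwn hw (hD.norm_eq_one k) ?_
    nth_rewrite 2 [hby]
    rw [inner_smul_right, ← mul_add]
    exact mul_pos hyp hk
  obtain ⟨k, hk⟩ := (hD.exists_between_or_tendsto hwn).resolve_right
    fun h => hwb (tendsto_nhds_unique h hacc)
  rcases hk with hk | hk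
  · have htk : IsBackwardTangent φ L (D k) := hk ▸ htan
    -- Shifted so that `w` is `D (j + 1)`, with `D j` and `D (j + 1 + 1)` on its two sides.
    obtain ⟨j, rfl⟩ : ∃ j, k = j + 1 := ⟨k - 1, by ring⟩
    have d0 : ∀ᶠ h in 𝓝[>] (0 : ℝ),
        quasipotential b O (y + h • D (j + 1)) < quasipotential b O y := by
      refine hdesc _ ?_
      rw [hk, real_inner_self_eq_norm_sq, hD.norm_eq_one]
      have := hl (j + 1)
      have := hD.inner_lt_one (j + 1)
      linarith
    have d1 : ∀ᶠ h in 𝓝[>] (0 : ℝ),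
        quasipotential b O (y + h • D (j + 1 + 1)) < quasipotential b O y := by
      refine hdesc _ ?_
      rw [hk, real_inner_comm]
      linarith [(htangent (j + 1)).1 htk]
    have d2 : ∀ᶠ h in 𝓝[>] (0 : ℝ),
        quasipotential b O (y + h • D j) < quasipotential b O y := by
      refine hdesc _ ?_
      rw [hk]
      linarith [(htangent j).2 htk]
    have hpass := eventually_passesBetween_or hφ.pos hφ.continuousOn hφ.finish hnc hw
      (hD.norm_eq_one j) (hD.norm_eq_one (j + 1 + 1)) hwn (hk ▸ hD.cross_pos j)
      (hk ▸ hD.cross_pos (j + 1))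
    rw [hk] at hpass
    -- For each small `h` one of the two sectors is crossed, so one of them is crossed for
    -- arbitrarily small `h`. The second claim is void, `w` being a backward tangent in `D`.
    rcases frequently_or_distrib.1 hpass.frequently with hf | hf
    · exact ⟨j, (hf.and_eventually (d2.and d0)), fun hno => absurd htk (hno _)⟩
    · exact ⟨j + 1, (hf.and_eventually (d0.and d1)), fun hno => absurd htk (hno _)⟩
  · have hev := (eventually_passesBetween hφ.pos hφ.continuousOn hφ.finish hnc hw
      (hD.norm_eq_one k) (hD.norm_eq_one (k + 1)) (hD.cross_pos k) hk.left hk.right).and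
      ((hdesc k (by linarith [hl k, hk.inner_left])).and
        (hdesc (k + 1) (by linarith [hr k, hk.inner_right])))
    exact ⟨k, hev.frequently, fun _ => hev⟩

end Quasipotential

open Quasipotential in
theorem mainTheorem1 (b : Plane → Plane) (hb : ContDiff ℝ ∞ b)
    (O : Plane) (hO : IsStableAttractor b O)
    (y : Plane) (hy : b y ≠ 0)
    (L : ℝ) (φ : ℝ → Plane) (hφ : IsMAP b O y L φ)
    (hbasin : ∀ t ∈ Icc 0 L, φ t ∈ basin b O)
    (bhat : Plane) (hbhat : bhat = ‖b y‖⁻¹ • b y)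
    (D : ℤ → Plane) (hD : RotationallyOrdered D)
    (hacute : ∀ k, max (max (-inner ℝ (D k) bhat) (-inner ℝ (D (k + 1)) bhat)) 0 ≤
      inner ℝ (D k) (D (k + 1)))
    (htangent : ∀ k,
      (IsBackwardTangent φ L (D k) → -inner ℝ (D (k + 1)) bhat < inner ℝ (D k) (D (k + 1))) ∧
      (IsBackwardTangent φ L (D (k + 1)) → -inner ℝ (D k) bhat < inner ℝ (D k) (D (k + 1)))) :
    ∃ k : ℤ,
      (∃ᶠ h in 𝓝[>] (0 : ℝ),
        PassesBetween φ L h (y + h • D k) (y + h • D (k + 1)) ∧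
        quasipotential b O (y + h • D k) < quasipotential b O y ∧
        quasipotential b O (y + h • D (k + 1)) < quasipotential b O y) ∧
      ((∀ j, ¬ IsBackwardTangent φ L (D j)) →
        ∀ᶠ h in 𝓝[>] (0 : ℝ),
          PassesBetween φ L h (y + h • D k) (y + h • D (k + 1)) ∧
          quasipotential b O (y + h • D k) < quasipotential b O y ∧
          quasipotential b O (y + h • D (k + 1)) < quasipotential b O y) := by
  obtain ⟨L', hmap, hL, hconst, hnc⟩ :=
    hφ.exists_last_arrival hb.continuous (hO.ne_of_ne_zero hy)
  have hconst' : ∀ t ∈ Icc L' L, φ t = φ L := fun t ht => by rw [hconst t ht, hφ.finish]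
  have hback : ∀ {d}, IsBackwardTangent φ L' d → IsBackwardTangent φ L d :=
    fun h => h.of_le hmap.pos.le hL hconst'
  obtain ⟨k, hfreq, hev⟩ := exists_neighbours hb hO hy hmap
    (fun t ht => hbasin t ⟨ht.1, ht.2.trans hL⟩) hnc hbhat hD hacute
    fun k => ⟨fun h => (htangent k).1 (hback h), fun h => (htangent k).2 (hback h)⟩
  exact ⟨k, hfreq.mono fun h hh => ⟨hh.1.of_le hL hconst', hh.2⟩,
    fun hno => (hev fun j hj => hno j (hback hj)).mono
      fun h hh => ⟨hh.1.of_le hL hconst', hh.2⟩⟩
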